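/- **Theorem 1.1.** Let $N\ge 1$, let $\alpha_1,\dots,\alpha_N\ge 0$ be real, and put $$x^A=x_1^{\alpha_1}\cdots x_N^{\alpha_N},\qquad D=N+\alpha_1+\dots+\alpha_N,\qquad \mathbb{R}^N_*=\{x\in\mathbb{R}^N: x_i>0\text{ whenever }\alpha_i>0\}.$$ Let $N_*$ be the set of real-valued functions $u\in C_0^\infty(\overline{\mathbb{R}^N_*})$ (smooth up to the boundary, with compact support in $\overline{\mathbb{R}^N_*}$) whose normal derivative vanishes on $\partial\mathbb{R}^N_*$, and let $S_A$ be the completion of $N_*$ under the norm $$\Big(\int_{\mathbb{R}^N_*}|\nabla u|^2x^A\,dx\Big)^{1/2}+\Big(\int_{\mathbb{R}^N_*}|u|^2|x|^2x^A\,dx\Big)^{1/2}.$$ Define the deficit $$\delta_A(u)=\Big(\int_{\mathbb{R}^N_*}|\nabla u|^2x^A\,dx\Big)^{1/2}\Big(\int_{\mathbb{R}^N_*}|u|^2|x|^2x^A\,dx\Big)^{1/2}-\frac D2\int_{\mathbb{R}^N_*}|u|^2x^A\,dx,$$ the set $E_{HUPA}=\{a e^{-b|x|^2}: a\in\mathbb{R},\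 b>0\}$, and $$d_A(u,E_{HUPA})=\inf_{c\in\mathbb{R},\ \lambda\neq 0}\Big(\int_{\mathbb{R}^N_*}\big|u-c\,e^{-\frac{|x|^2}{2\lambda^2}}\big|^2x^A\,dx\Big)^{1/2}.$$ Then every $u\in S_A$ satisfies $\int_{\mathbb{R}^N_*}|u|^2x^A\,dx<\infty$ and $$\delta_A(u)\ \ge\ d_A^2(u,E_{HUPA}).$$ Moreover, if $x^A$ is partial, that is, if $\alpha_i=0$ for some $i$, then equality is attained by some $u\in S_A$ with $u\notin E_{HUPA}$ (that is, $u$ is not equal almost everywhere on $\mathbb{R}^N_*$ to an element of $E_{HUPA}$); indeed, for every $i$ with $\alpha_i=0$, the function $u(x)=x_ie^{-|x|^2/2}$ belongs to $S_A$, is not in $E_{HUPA}$, and attains equality. -/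

import Mathlib

open MeasureTheory Filter Topology
open scoped ContDiff ENNReal

namespace MonomialHUP

/-- The monomial weight `x ^ A = x₁ ^ α₁ ⋯ x_N ^ α_N` (used only on the chamber below, where
`x i > 0` whenever `α i > 0`; a factor with `α i = 0` is `1`). -/
noncomputable def weight {N : ℕ} (α : Fin N → ℝ) (x : EuclideanSpace ℝ (Fin N)) : ℝ :=
  ∏ i, x i ^ α i

/-- The open Weyl chamber `{x : x i > 0 if α i > 0}`. -/
def chamber {N : ℕ} (α : Fin N → ℝ) : Set (EuclideanSpace ℝ (Fin N)) :=
  {x | ∀ i, 0 < α i → 0 < x i}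

/-- The weight is full if every exponent is positive. -/
def IsFull {N : ℕ} (α : Fin N → ℝ) : Prop := ∀ i, 0 < α i

/-- The weight is partial if it is not full. -/
def IsPartial {N : ℕ} (α : Fin N → ℝ) : Prop := ¬ IsFull α

/-- The homogeneous dimension `D = N + α₁ + ⋯ + α_N`. -/
noncomputable def homDim {N : ℕ} (α : Fin N → ℝ) : ℝ := N + ∑ i, α i

/-- The measure `x ^ A dx` on the chamber. -/
noncomputable def wMeasure {N : ℕ} (α : Fin N → ℝ) : Measure (EuclideanSpace ℝ (Fin N)) :=
  (volume.restrict (chamber α)).withDensity fun x => ENNReal.ofReal (weight α x)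

/-- The class of smooth functions on the closed chamber with compact support and vanishing
normal derivative on the boundary. A function smooth up to the boundary of the closed chamber is
represented by a smooth compactly supported extension to the whole space. The outer normal on the
face `x i = 0` (where `α i > 0`) is `-e_i`; at points where several faces meet, the condition for
each of these faces is the limit of the condition at the neighbouring regular points. -/
structure IsNeumannTest {N : ℕ} (α : Fin N → ℝ) (φ : EuclideanSpace ℝ (Fin N) → ℝ) : Prop where
  smooth : ContDiff ℝ ∞ φ
  compactSupport : HasCompactSupport φ
  neumann : ∀ x ∈ closure (chamber α), ∀ i, 0 < α i → x i = 0 → gradient φ x i = 0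

/-- `HasGradientSA α u G`: the function `u` belongs to the completion `S_A` of the Neumann test
functions under the norm `(∫ |∇u|² x^A)^{1/2} + (∫ |u|² |x|² x^A)^{1/2}`, and `G` is its gradient.
The map `φ ↦ (φ, ∇φ)` is an isometry into the complete space
`L²(|x|² x^A dx) × L²(x^A dx; ℝ^N)`, so the completion is the closure of its image: the pairs
`(u, G)` for which some sequence of test functions converges to `u`, and their gradients to `G`,
in the respective norms. (`G` is then the distributional gradient of `u` on the chamber, hence
determined by `u` up to null sets.) -/
structure HasGradientSA {N : ℕ} (α : Fin N → ℝ) (u : EuclideanSpace ℝ (Fin N) → ℝ)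
    (G : EuclideanSpace ℝ (Fin N) → EuclideanSpace ℝ (Fin N)) : Prop where
  aestronglyMeasurable : AEStronglyMeasurable u (wMeasure α)
  aestronglyMeasurable_grad : AEStronglyMeasurable G (wMeasure α)
  exists_approx : ∃ φ : ℕ → EuclideanSpace ℝ (Fin N) → ℝ,
    (∀ n, IsNeumannTest α (φ n)) ∧
    Tendsto (fun n => ∫⁻ x, ‖gradient (φ n) x - G x‖ₑ ^ 2 ∂wMeasure α) atTop (𝓝 0) ∧
    Tendsto (fun n => ∫⁻ x, ‖φ n x - u x‖ₑ ^ 2 * ‖x‖ₑ ^ 2 ∂wMeasure α) atTop (𝓝 0)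

/-- The deficit
`δ_A(u) = (∫ |∇u|² x^A)^{1/2} (∫ |u|² |x|² x^A)^{1/2} - (D / 2) ∫ |u|² x^A`,
for a function `u` with gradient `G`. -/
noncomputable def deficit {N : ℕ} (α : Fin N → ℝ) (u : EuclideanSpace ℝ (Fin N) → ℝ)
    (G : EuclideanSpace ℝ (Fin N) → EuclideanSpace ℝ (Fin N)) : ℝ :=
  √(∫ x, ‖G x‖ ^ 2 ∂wMeasure α) * √(∫ x, |u x| ^ 2 * ‖x‖ ^ 2 ∂wMeasure α)
    - homDim α / 2 * ∫ x, |u x| ^ 2 ∂wMeasure α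

/-- The set of Gaussians `a e^{-b |x|²}`, `a ∈ ℝ`, `b > 0`. -/
def gaussians (N : ℕ) : Set (EuclideanSpace ℝ (Fin N) → ℝ) :=
  {v | ∃ a b : ℝ, 0 < b ∧ v = fun x => a * Real.exp (-b * ‖x‖ ^ 2)}

/-- The distance `d_A(u, E) = inf_{c, l ≠ 0} (∫ |u - c e^{-|x|² / (2 l²)}|² x^A)^{1/2}`. -/
noncomputable def distGaussians {N : ℕ} (α : Fin N → ℝ)
    (u : EuclideanSpace ℝ (Fin N) → ℝ) : ℝ :=
  ⨅ p : ℝ × {l : ℝ // l ≠ 0},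
    √(∫ x, |u x - p.1 * Real.exp (-(1 / (2 * (p.2 : ℝ) ^ 2)) * ‖x‖ ^ 2)| ^ 2 ∂wMeasure α)

end MonomialHUP

/-!
Write `w` for the weight `x ^ A` on the chamber and put `v = φ e^{s |x|² / 2}` for a test function
`φ` and a scale `s > 0`. Integrating `x · ∇(φ²)` by parts against `w`, which is homogeneous of
degree `D - N` and vanishes on the faces, gives
`∫ |∇v|² e^{-s |x|²} w = ∫ |∇φ|² w + s² ∫ |x|² φ² w - s D ∫ φ² w`
(`integral_norm_gradient_add_sq`). The measure `e^{-s |x|²} w dx` has Poincaré constant `2 s`, so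
the left-hand side is at least `2 s ∫ |v - c|² e^{-s |x|²} w = 2 s ∫ |φ - c e^{-s |x|² / 2}|² w`
for a suitable constant `c` (`exists_gaussian_stability`). Both sides pass to the completion
(`HasGradientSA.memLp_and_dist_sq_le_deficit`), where the weak uncertainty principle
`D ∫ φ² w ≤ ∫ |∇φ|² w + ∫ |x|² φ² w` also supplies the convergence in `L²(w)`. After division by
`s`, the infimum of the right-hand side over `s` is `2 (∫ |∇u|² w)^{1/2} (∫ |x|² u² w)^{1/2}` minus
`D ∫ u² w`, that is, twice the deficit.

The Poincaré inequality (`exists_poincare`) tensorises: `e^{-s |x|²} w dx` is, up to its mass, a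
product of probability measures on lines and half-lines, and the Efron–Stein inequality
(`variance_pi_le`) bounds the variance by the sum of the averaged variances in one coordinate. In
one dimension (`variance_lineMeasure_le`) the inequality follows by integrating the derivative of
`(h - h z) ^ 2 t ^ a e^{-s t²} / (t - z)` on either side of the maximum point `z` of the density.
None of these steps needs the Neumann condition.

For `u = x_i e^{-|x|² / 2}` with `α_i = 0`, radial cutoffs respect the Neumann condition on the
other faces, so `u` lies in the completion. Integration by parts computes all moments, and the
deficit equals `∫ u² w`; this is also the squared distance, since `u` is odd in `x_i` and therefore
orthogonal to every Gaussian.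
-/

namespace MonomialHUP

open ProbabilityTheory

/-! ### The Efron–Stein inequality and resampling of one coordinate -/

section EfronStein

variable {Ω Ω' : Type*} [MeasurableSpace Ω] [MeasurableSpace Ω']

lemma integrable_of_measurable_of_bound {μ : Measure Ω} [IsFiniteMeasure μ] {f : Ω → ℝ}
    (hf : Measurable f) {C : ℝ} (hC : ∀ x, |f x| ≤ C) : Integrable f μ :=
  Integrable.of_bound hf.aestronglyMeasurable C (ae_of_all _ hC)

lemma variance_eq_of_bound {μ : Measure Ω} [IsProbabilityMeasure μ] {f : Ω → ℝ}
    (hf : Measurable f) {C : ℝ} (hC : ∀ x, |f x| ≤ C) :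
    Var[f; μ] = ∫ x, f x ^ 2 ∂μ - (∫ x, f x ∂μ) ^ 2 := by
  rw [variance_eq_sub (MemLp.of_bound hf.aestronglyMeasurable C (ae_of_all _ hC))]
  rfl

lemma abs_integral_le_of_bound {μ : Measure Ω} [IsProbabilityMeasure μ] {f : Ω → ℝ}
    {C : ℝ} (hC : ∀ x, |f x| ≤ C) : |∫ x, f x ∂μ| ≤ C := by
  simpa using norm_integral_le_of_norm_le_const (μ := μ) (f := f) (C := C) (ae_of_all _ hC)

lemma abs_sq_le_of_bound {r C : ℝ} (h : |r| ≤ C) : |r ^ 2| ≤ C ^ 2 := by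
  rw [abs_pow]; gcongr

lemma variance_le_sq_of_bound {μ : Measure Ω} [IsProbabilityMeasure μ] {f : Ω → ℝ}
    (hf : Measurable f) {C : ℝ} (hC : ∀ x, |f x| ≤ C) : Var[f; μ] ≤ C ^ 2 := by
  rw [variance_eq_of_bound hf hC]
  have := abs_le.1 (abs_integral_le_of_bound (μ := μ) fun x => abs_sq_le_of_bound (hC x))
  nlinarith [sq_nonneg (∫ x, f x ∂μ)]

lemma abs_variance_le_sq_of_bound {μ : Measure Ω} [IsProbabilityMeasure μ] {f : Ω → ℝ}
    (hf : Measurable f) {C : ℝ} (hC : ∀ x, |f x| ≤ C) : |Var[f; μ]| ≤ C ^ 2 := by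
  rw [abs_of_nonneg (variance_nonneg _ _)]
  exact variance_le_sq_of_bound hf hC

lemma measurable_integral_right {ν : Measure Ω'} [SFinite ν] {F : Ω × Ω' → ℝ}
    (hF : Measurable F) : Measurable fun x => ∫ y, F (x, y) ∂ν :=
  (hF.stronglyMeasurable.integral_prod_right' (ν := ν)).measurable

lemma measurable_variance_right {ν : Measure Ω'} [IsProbabilityMeasure ν] {F : Ω × Ω' → ℝ}
    (hF : Measurable F) {C : ℝ} (hC : ∀ p, |F p| ≤ C) :
    Measurable fun x => Var[fun y => F (x, y); ν] := by
  have h : ∀ x, Var[fun y => F (x, y); ν]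
      = ∫ y, F (x, y) ^ 2 ∂ν - (∫ y, F (x, y) ∂ν) ^ 2 := fun x =>
    variance_eq_of_bound (hF.comp measurable_prodMk_left) fun y => hC _
  simp_rw [h]
  exact (measurable_integral_right (hF.pow_const 2)).sub
    ((measurable_integral_right hF).pow_const 2)

/-- The law of total variance on a product space. -/
lemma variance_prod_eq {μ : Measure Ω} {ν : Measure Ω'} [IsProbabilityMeasure μ]
    [IsProbabilityMeasure ν] {F : Ω × Ω' → ℝ} (hF : Measurable F) {C : ℝ}
    (hC : ∀ p, |F p| ≤ C) :
    Var[F; μ.prod ν] = ∫ x, Var[fun y => F (x, y); ν] ∂μ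
      + Var[fun x => ∫ y, F (x, y) ∂ν; μ] := by
  have h : ∀ x, Var[fun y => F (x, y); ν]
      = ∫ y, F (x, y) ^ 2 ∂ν - (∫ y, F (x, y) ∂ν) ^ 2 := fun x =>
    variance_eq_of_bound (hF.comp measurable_prodMk_left) fun y => hC _
  have hb : ∀ x, |∫ y, F (x, y) ∂ν| ≤ C := fun x => abs_integral_le_of_bound fun y => hC _
  rw [variance_eq_of_bound hF hC, variance_eq_of_bound (measurable_integral_right hF) hb]
  simp_rw [h]
  rw [integral_sub, integral_prod, integral_prod]
  · ring
  · exact integrable_of_measurable_of_bound hF hC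
  · exact integrable_of_measurable_of_bound (hF.pow_const 2) fun p => abs_sq_le_of_bound (hC p)
  · exact integrable_of_measurable_of_bound (measurable_integral_right (hF.pow_const 2))
      fun x => abs_integral_le_of_bound fun y => abs_sq_le_of_bound (hC _)
  · exact integrable_of_measurable_of_bound ((measurable_integral_right hF).pow_const 2)
      fun x => abs_sq_le_of_bound (hb x)

/-- Convexity of the variance: averaging over a parameter decreases it. -/
lemma variance_integral_le {μ : Measure Ω} {ν : Measure Ω'} [IsProbabilityMeasure μ]
    [IsProbabilityMeasure ν] {F : Ω × Ω' → ℝ} (hF : Measurable F) {C : ℝ}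
    (hC : ∀ p, |F p| ≤ C) :
    Var[fun y => ∫ x, F (x, y) ∂μ; ν] ≤ ∫ x, Var[fun y => F (x, y); ν] ∂μ := by
  have hF' : Measurable fun p : Ω' × Ω => F (p.2, p.1) := hF.comp measurable_swap
  have hm : Measurable fun x => ∫ y, F (x, y) ∂ν := measurable_integral_right hF
  have hb : ∀ x, |∫ y, F (x, y) ∂ν| ≤ C := fun x => abs_integral_le_of_bound fun y => hC _
  have hFm : ∀ y, Measurable fun x => F (x, y) := fun y => hF.comp measurable_prodMk_right
  -- the centred function, each slice `y ↦ G (x, y)` having mean zero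
  set G : Ω × Ω' → ℝ := fun p => F p - ∫ y, F (p.1, y) ∂ν with hG
  have hGm : Measurable G := hF.sub (hm.comp measurable_fst)
  have hGb : ∀ p, |G p| ≤ 2 * C := fun p => by
    have h1 := abs_le.1 (hC p)
    have h2 := abs_le.1 (hb p.1)
    exact abs_le.2 ⟨by simp only [hG]; linarith, by simp only [hG]; linarith⟩
  have hmean : ∫ y, ∫ x, F (x, y) ∂μ ∂ν = ∫ x, ∫ y, F (x, y) ∂ν ∂μ :=
    (integral_integral_swap (f := fun x y => F (x, y))
      (integrable_of_measurable_of_bound hF hC)).symm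
  have h1 : ∀ y, (∫ x, F (x, y) ∂μ) - ∫ y, ∫ x, F (x, y) ∂μ ∂ν = ∫ x, G (x, y) ∂μ := by
    intro y
    rw [hmean, ← integral_sub (integrable_of_measurable_of_bound (hFm y) fun x => hC _)
      (integrable_of_measurable_of_bound hm hb)]
  have h2 : ∀ x, Var[fun y => F (x, y); ν] = ∫ y, G (x, y) ^ 2 ∂ν := fun x =>
    variance_eq_integral (hF.comp measurable_prodMk_left).aemeasurable
  have hswap : ∫ x, ∫ y, G (x, y) ^ 2 ∂ν ∂μ = ∫ y, ∫ x, G (x, y) ^ 2 ∂μ ∂ν :=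
    integral_integral_swap (f := fun x y => G (x, y) ^ 2)
      (integrable_of_measurable_of_bound (hGm.pow_const 2) fun p => abs_sq_le_of_bound (hGb p))
  rw [variance_eq_integral (measurable_integral_right hF').aemeasurable]
  simp_rw [h2]
  rw [hswap]
  have hGm' : Measurable fun p : Ω' × Ω => G (p.2, p.1) := hGm.comp measurable_swap
  refine integral_mono ?_ ?_ fun y => ?_
  · simp_rw [h1]
    exact integrable_of_measurable_of_bound ((measurable_integral_right hGm').pow_const 2)
      fun y => abs_sq_le_of_bound (abs_integral_le_of_bound fun x => hGb _)
  · exact integrable_of_measurable_of_bound (measurable_integral_right (hGm'.pow_const 2))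
      fun y => abs_integral_le_of_bound fun x => abs_sq_le_of_bound (hGb _)
  · simp only [h1]
    have := variance_nonneg (fun x => G (x, y)) μ
    have hGy : Measurable fun x => G (x, y) := hGm.comp measurable_prodMk_right
    rw [variance_eq_of_bound hGy fun x => hGb _] at this
    linarith

lemma measurable_update_prod {n : ℕ} (i : Fin n) :
    Measurable fun p : (Fin n → Ω) × Ω => Function.update p.1 i p.2 := by
  refine measurable_pi_iff.2 fun j => ?_
  by_cases h : j = i
  · subst h; simpa using measurable_snd
  · simpa [h] using! (measurable_pi_apply j).comp measurable_fst

/-- The **Efron–Stein inequality**: the variance under a product measure is at most the sum of the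
averaged variances in the single coordinates. -/
theorem variance_pi_le {n : ℕ} (μ : Fin n → Measure Ω) [∀ i, IsProbabilityMeasure (μ i)]
    {f : (Fin n → Ω) → ℝ} (hf : Measurable f) {C : ℝ} (hC : ∀ x, |f x| ≤ C) :
    Var[f; Measure.pi μ]
      ≤ ∑ i, ∫ x, Var[fun t => f (Function.update x i t); μ i] ∂Measure.pi μ := by
  induction n with
  | zero =>
    have : f = fun _ => f default := funext fun x => by rw [Subsingleton.elim x default]
    rw [this]
    simp [variance_eq_integral]
  | succ n ih =>
    set π := Measure.pi fun j : Fin n => μ j.succ with hπ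
    have hmp₀ : MeasurePreserving (fun p : Ω × (Fin n → Ω) => (Fin.cons p.1 p.2 : Fin (n+1) → Ω))
        ((μ 0).prod π) (Measure.pi μ) := by
      simpa [MeasurableEquiv.piFinSuccAbove, hπ] using!
        (measurePreserving_piFinSuccAbove μ 0).symm
    have hmp : MeasurePreserving (fun p : (Fin n → Ω) × Ω => (Fin.cons p.2 p.1 : Fin (n+1) → Ω))
        (π.prod (μ 0)) (Measure.pi μ) := hmp₀.comp Measure.measurePreserving_swap
    have hcons : Measurable fun p : (Fin n → Ω) × Ω => (Fin.cons p.2 p.1 : Fin (n+1) → Ω) :=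
      hmp.measurable
    set F : (Fin n → Ω) × Ω → ℝ := fun p => f (Fin.cons p.2 p.1) with hF
    have hFm : Measurable F := hf.comp hcons
    have hFC : ∀ p, |F p| ≤ C := fun p => hC _
    have hint : ∀ g : (Fin (n+1) → Ω) → ℝ, Measurable g → ∫ x, g x ∂Measure.pi μ
        = ∫ p, g (Fin.cons p.2 p.1) ∂π.prod (μ 0) := fun g hg => by
      rw [← hmp.map_eq, integral_map hcons.aemeasurable hg.aestronglyMeasurable]
    have hupd : ∀ i : Fin (n+1), Measurable fun p : (Fin (n+1) → Ω) × Ω =>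
        f (Function.update p.1 i p.2) := fun i => hf.comp (measurable_update_prod i)
    have hvar : ∀ i : Fin (n+1), Measurable fun x =>
        Var[fun t => f (Function.update x i t); μ i] := fun i =>
      measurable_variance_right (F := fun p : (Fin (n+1) → Ω) × Ω =>
        f (Function.update p.1 i p.2)) (hupd i) fun p => hC _
    have hm1 : ∀ i : Fin (n+1), Measurable fun p : (Fin n → Ω) × Ω =>
        Var[fun t => f (Function.update (Fin.cons p.2 p.1 : Fin (n+1) → Ω) i t); μ i] :=
      fun i => (hvar i).comp hcons
    have hb1 : ∀ (i : Fin (n+1)) (p : (Fin n → Ω) × Ω),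
        |Var[fun t => f (Function.update (Fin.cons p.2 p.1 : Fin (n+1) → Ω) i t); μ i]| ≤ C ^ 2 :=
      fun i p => abs_variance_le_sq_of_bound ((hupd i).comp measurable_prodMk_left) fun t => hC _
    have hfb : ∀ y, |∫ t, F (y, t) ∂μ 0| ≤ C := fun y => abs_integral_le_of_bound fun t => hFC _
    have hV : Var[f; Measure.pi μ] = Var[F; π.prod (μ 0)] :=
      (hmp.variance_fun_comp hf.aemeasurable).symm
    rw [hV, variance_prod_eq hFm hFC, Fin.sum_univ_succ]
    refine add_le_add (le_of_eq ?_) ?_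
    · rw [hint _ (hvar 0), integral_prod]
      · simp [hF]
      · exact integrable_of_measurable_of_bound (hm1 0) (hb1 0)
    · refine (ih (fun j => μ j.succ) (measurable_integral_right hFm) hfb).trans
        (Finset.sum_le_sum fun j _ => ?_)
      rw [hint _ (hvar j.succ), integral_prod]
      · have hupdF : Measurable fun p : (Fin n → Ω) × Ω × Ω =>
            F (Function.update p.1 j p.2.2, p.2.1) := by
          refine hFm.comp (Measurable.prodMk ?_ (by fun_prop))
          exact (measurable_update_prod j).comp (by fun_prop : Measurable
            fun p : (Fin n → Ω) × Ω × Ω => (p.1, p.2.2))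
        refine integral_mono ?_ ?_ fun y => ?_
        · have hm2 : Measurable fun p : (Fin n → Ω) × Ω =>
              ∫ s, F (Function.update p.1 j p.2, s) ∂μ 0 :=
            (measurable_integral_right hFm).comp (measurable_update_prod j)
          exact integrable_of_measurable_of_bound
            (measurable_variance_right (F := fun p : (Fin n → Ω) × Ω =>
              ∫ s, F (Function.update p.1 j p.2, s) ∂μ 0) hm2 fun p => hfb _) fun y =>
            abs_variance_le_sq_of_bound
              (f := fun t => ∫ s, F (Function.update y j t, s) ∂μ 0)
              (hm2.comp measurable_prodMk_left) fun t => hfb _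
        · exact integrable_of_measurable_of_bound (measurable_integral_right (hm1 j.succ))
            fun y => abs_integral_le_of_bound fun t => hb1 j.succ _
        · have := variance_integral_le (μ := μ 0) (ν := μ j.succ)
            (F := fun p : Ω × Ω => F (Function.update y j p.2, p.1))
            (hupdF.comp measurable_prodMk_left) fun p => hFC _
          simpa only [hF, Fin.cons_update] using this
      · exact integrable_of_measurable_of_bound (hm1 j.succ) (hb1 j.succ)

/-- Resampling one coordinate of a product probability measure does not change the measure. -/
lemma measurePreserving_update {n : ℕ} (μ : Fin n → Measure Ω) [∀ i, IsProbabilityMeasure (μ i)]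
    (i : Fin n) :
    MeasurePreserving (fun p : (Fin n → Ω) × Ω => Function.update p.1 i p.2)
      ((Measure.pi μ).prod (μ i)) (Measure.pi μ) := by
  refine ⟨measurable_update_prod i, (Measure.pi_eq fun s hs => ?_).symm⟩
  rw [Measure.map_apply (measurable_update_prod i) (MeasurableSet.univ_pi hs)]
  have : (fun p : (Fin n → Ω) × Ω => Function.update p.1 i p.2) ⁻¹' (Set.univ.pi s)
      = (Set.univ.pi (Function.update s i Set.univ)) ×ˢ s i := by
    ext ⟨x, t⟩
    simp only [Set.mem_preimage, Set.mem_univ_pi, Set.mem_prod]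
    constructor
    · intro h
      refine ⟨fun j => ?_, by simpa using h i⟩
      by_cases hj : j = i
      · subst hj; simp
      · simpa [hj] using h j
    · rintro ⟨h, ht⟩ j
      by_cases hj : j = i
      · subst hj; simpa using ht
      · simpa [hj] using h j
  rw [this, Measure.prod_prod, Measure.pi_pi, ← Finset.mul_prod_erase Finset.univ
    (fun j => μ j (s j)) (Finset.mem_univ i), ← Finset.mul_prod_erase Finset.univ _
    (Finset.mem_univ i)]
  simp only [Function.update_self, measure_univ, one_mul]
  rw [mul_comm]
  congr 1
  refine Finset.prod_congr rfl fun j hj => ?_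
  rw [Function.update_of_ne (Finset.ne_of_mem_erase hj)]

lemma ae_integrable_update {n : ℕ} {μ : Fin n → Measure Ω} [∀ i, IsProbabilityMeasure (μ i)]
    {F : (Fin n → Ω) → ℝ} (hF : Integrable F (Measure.pi μ)) (i : Fin n) :
    ∀ᵐ x ∂Measure.pi μ, Integrable (fun t => F (Function.update x i t)) (μ i) :=
  ((measurePreserving_update μ i).integrable_comp_of_integrable hF).prod_right_ae

lemma integral_pi_eq_integral_update {n : ℕ} {μ : Fin n → Measure Ω}
    [∀ i, IsProbabilityMeasure (μ i)] {F : (Fin n → Ω) → ℝ}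
    (hF : Integrable F (Measure.pi μ)) (i : Fin n) :
    ∫ x, F x ∂Measure.pi μ = ∫ x, ∫ t, F (Function.update x i t) ∂μ i ∂Measure.pi μ := by
  have h := measurePreserving_update μ i
  rw [← integral_prod (f := fun p : (Fin n → Ω) × Ω => F (Function.update p.1 i p.2))
    (h.integrable_comp_of_integrable hF)]
  conv_lhs => rw [← h.map_eq]
  exact integral_map h.measurable.aemeasurable (by rw [h.map_eq]; exact hF.aestronglyMeasurable)

end EfronStein

/-! ### One-dimensional weighted Gaussian measures -/

section Line

/-- The one-dimensional chamber: the half-line `t > 0` if `a > 0`, the whole line otherwise. -/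
def ray (a : ℝ) : Set ℝ := {t | 0 < a → 0 < t}

lemma ray_of_pos {a : ℝ} (ha : 0 < a) : ray a = Set.Ioi 0 := by
  ext t; simp [ray, ha]

lemma ray_zero : ray 0 = Set.univ := by
  ext t; simp [ray]

lemma measurableSet_ray (a : ℝ) : MeasurableSet (ray a) := by
  by_cases ha : 0 < a
  · rw [ray_of_pos ha]; exact measurableSet_Ioi
  · have : ray a = Set.univ := by ext t; simp [ray, ha]
    rw [this]; exact MeasurableSet.univ

/-- The unnormalised one-dimensional density `t ^ a e^{-s t²}`, meant on `ray a`. -/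
noncomputable def lineWeight (s a t : ℝ) : ℝ := t ^ a * Real.exp (-s * t ^ 2)

lemma lineWeight_pos {s a t : ℝ} (ha : 0 ≤ a) (ht : t ∈ ray a) : 0 < lineWeight s a t := by
  rcases ha.eq_or_lt with rfl | ha
  · simp [lineWeight, Real.exp_pos]
  · exact mul_pos (Real.rpow_pos_of_pos (ht ha) _) (Real.exp_pos _)

lemma measurable_lineWeight (s a : ℝ) : Measurable (lineWeight s a) := by
  unfold lineWeight; fun_prop

lemma integrableOn_lineWeight {s a : ℝ} (hs : 0 < s) (ha : 0 ≤ a) :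
    IntegrableOn (lineWeight s a) (ray a) :=
  (integrable_rpow_mul_exp_neg_mul_sq hs (by linarith)).integrableOn

/-- At `t = 0`, which lies in `ray a` only for `a = 0`, the quotient `a / t` is `0`, as it
should be. -/
lemma hasDerivAt_lineWeight {s a t : ℝ} (ha : 0 ≤ a) (ht : t ∈ ray a) :
    HasDerivAt (lineWeight s a) ((a / t - 2 * s * t) * lineWeight s a t) t := by
  have h2 : HasDerivAt (fun t : ℝ => Real.exp (-s * t ^ 2))
      (Real.exp (-s * t ^ 2) * (-s * (2 * t))) t := by
    simpa using (((hasDerivAt_id t).pow 2).const_mul (-s)).exp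
  rcases ha.eq_or_lt with rfl | ha
  · have : lineWeight s 0 = fun t => Real.exp (-s * t ^ 2) := by
      funext t; simp [lineWeight]
    rw [this]
    convert h2 using 1
    simp; ring
  · have ht0 : 0 < t := ht ha
    have h1 := Real.hasDerivAt_rpow_const (x := t) (p := a) (Or.inl ht0.ne')
    refine (h1.mul h2).congr_deriv ?_
    rw [Real.rpow_sub_one ht0.ne', lineWeight]
    field_simp
    ring

lemma mul_div_self_of_mem_ray {a t : ℝ} (ha : 0 ≤ a) (ht : t ∈ ray a) : t * (a / t) = a := by
  rcases ha.eq_or_lt with rfl | ha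
  · simp
  · field_simp [(ht ha).ne']

/-- The normalisation constant of `lineWeight` on `ray a`. -/
noncomputable def lineMass (s a : ℝ) : ℝ := ∫ t in ray a, lineWeight s a t

lemma volume_ray_pos (a : ℝ) : 0 < volume (ray a) := by
  refine lt_of_lt_of_le ?_ (measure_mono (s := Set.Ioi (0 : ℝ)) fun t ht _ => ht)
  simp

lemma lineMass_pos {s a : ℝ} (hs : 0 < s) (ha : 0 ≤ a) : 0 < lineMass s a := by
  rw [lineMass, setIntegral_pos_iff_support_of_nonneg_ae]
  · refine (volume_ray_pos a).trans_le (measure_mono fun t ht => ⟨?_, ht⟩)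
    exact (lineWeight_pos ha ht).ne'
  · exact (ae_restrict_iff' (measurableSet_ray a)).2
      (ae_of_all _ fun t ht => (lineWeight_pos ha ht).le)
  · exact integrableOn_lineWeight hs ha

/-- The density of the probability measure on the line proportional to `lineWeight` on `ray a`. -/
noncomputable def lineDensity (s a : ℝ) : ℝ → ℝ :=
  (ray a).indicator fun t => lineWeight s a t / lineMass s a

/-- The probability measure proportional to `t ^ a e^{-s t²} dt` on `ray a`. -/
noncomputable def lineMeasure (s a : ℝ) : Measure ℝ :=
  volume.withDensity fun t => ENNReal.ofReal (lineDensity s a t)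

lemma measurable_lineDensity (s a : ℝ) : Measurable (lineDensity s a) :=
  ((measurable_lineWeight s a).div_const _).indicator (measurableSet_ray a)

lemma lineDensity_nonneg {s a : ℝ} (hs : 0 < s) (ha : 0 ≤ a) (t : ℝ) : 0 ≤ lineDensity s a t :=
  Set.indicator_nonneg
    (fun _ ht => div_nonneg (lineWeight_pos ha ht).le (lineMass_pos hs ha).le) t

lemma integrable_lineDensity {s a : ℝ} (hs : 0 < s) (ha : 0 ≤ a) :
    Integrable (lineDensity s a) :=
  (integrable_indicator_iff (measurableSet_ray a)).2 ((integrableOn_lineWeight hs ha).div_const _)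

lemma integral_lineDensity {s a : ℝ} (hs : 0 < s) (ha : 0 ≤ a) :
    ∫ t, lineDensity s a t = 1 := by
  rw [lineDensity, integral_indicator (measurableSet_ray a), integral_div]
  exact div_self (lineMass_pos hs ha).ne'

lemma isProbabilityMeasure_lineMeasure {s a : ℝ} (hs : 0 < s) (ha : 0 ≤ a) :
    IsProbabilityMeasure (lineMeasure s a) := by
  constructor
  rw [lineMeasure, withDensity_apply _ MeasurableSet.univ, Measure.restrict_univ,
    ← ofReal_integral_eq_lintegral_ofReal (integrable_lineDensity hs ha)
      (ae_of_all _ (lineDensity_nonneg hs ha)), integral_lineDensity hs ha, ENNReal.ofReal_one]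

lemma integral_lineMeasure {s a : ℝ} (hs : 0 < s) (ha : 0 ≤ a) (F : ℝ → ℝ) :
    ∫ t, F t ∂lineMeasure s a = (lineMass s a)⁻¹ * ∫ t in ray a, F t * lineWeight s a t := by
  rw [lineMeasure, integral_withDensity_eq_integral_toReal_smul
    (measurable_lineDensity s a).ennreal_ofReal (ae_of_all _ fun _ => ENNReal.ofReal_lt_top),
    ← integral_const_mul, ← integral_indicator (measurableSet_ray a)]
  refine integral_congr_ae (ae_of_all _ fun t => ?_)
  simp only [ENNReal.toReal_ofReal (lineDensity_nonneg hs ha t), smul_eq_mul]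
  by_cases ht : t ∈ ray a
  · simp only [lineDensity, Set.indicator_of_mem ht]; ring
  · simp [lineDensity, Set.indicator_of_notMem ht]

lemma integrable_lineMeasure_iff {s a : ℝ} (hs : 0 < s) (ha : 0 ≤ a) (F : ℝ → ℝ) :
    Integrable F (lineMeasure s a)
      ↔ IntegrableOn (fun t => F t * lineWeight s a t) (ray a) := by
  have hZ := lineMass_pos hs ha
  rw [lineMeasure, integrable_withDensity_iff (measurable_lineDensity s a).ennreal_ofReal
    (ae_of_all _ fun _ => ENNReal.ofReal_lt_top), ← integrable_indicator_iff (measurableSet_ray a)]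
  have : (fun t => F t * (ENNReal.ofReal (lineDensity s a t)).toReal)
      = fun t => (lineMass s a)⁻¹ *
        (ray a).indicator (fun t => F t * lineWeight s a t) t := by
    funext t
    rw [ENNReal.toReal_ofReal (lineDensity_nonneg hs ha t)]
    by_cases ht : t ∈ ray a
    · simp only [lineDensity, Set.indicator_of_mem ht]; ring
    · simp [lineDensity, Set.indicator_of_notMem ht]
  rw [this, integrable_const_mul_iff (isUnit_iff_ne_zero.2 (inv_ne_zero hZ.ne'))]

/-- If `Ψ` and its derivative are integrable on `ray a` and `Ψ` vanishes continuously at the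
endpoint, if there is one, then the derivative has integral zero. -/
lemma setIntegral_ray_deriv_eq_zero {a : ℝ} (ha : 0 ≤ a) {f f' : ℝ → ℝ}
    (hcont : ContinuousWithinAt f (Set.Ici 0) 0) (hf0 : f 0 = 0)
    (hderiv : ∀ t ∈ ray a, HasDerivAt f (f' t) t) (hf : IntegrableOn f (ray a))
    (hf' : IntegrableOn f' (ray a)) : ∫ t in ray a, f' t = 0 := by
  rcases ha.eq_or_lt with rfl | ha
  · rw [ray_zero] at *
    rw [setIntegral_univ]
    exact integral_eq_zero_of_hasDerivAt_of_integrable (fun t => hderiv t trivial)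
      (integrableOn_univ.1 hf') (integrableOn_univ.1 hf)
  · rw [ray_of_pos ha] at *
    have := integral_Ioi_of_hasDerivAt_of_tendsto hcont hderiv hf'
      (tendsto_zero_of_hasDerivAt_of_integrableOn_Ioi hderiv hf' hf)
    rw [this, hf0, sub_zero]

/-- Integration by parts against `t ^ a e^{-s t²} dt`. There is no boundary term, because
`t ^ (a + 1)` vanishes at `0`. -/
theorem integral_id_mul_deriv_lineMeasure {s a : ℝ} (hs : 0 < s) (ha : 0 ≤ a) {h h' : ℝ → ℝ}
    (hh : ∀ t, HasDerivAt h (h' t) t) (h0 : Integrable h (lineMeasure s a))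
    (h1 : Integrable (fun t => t * h' t) (lineMeasure s a))
    (h2 : Integrable (fun t => t ^ 2 * h t) (lineMeasure s a)) :
    ∫ t, t * h' t ∂lineMeasure s a
      = ∫ t, (2 * s * t ^ 2 - (a + 1)) * h t ∂lineMeasure s a := by
  have hcont : Continuous h := continuous_iff_continuousAt.2 fun t => (hh t).continuousAt
  have h3 : Integrable (fun t => t * h t) (lineMeasure s a) := by
    refine (h0.norm.add h2.norm).mono' (by fun_prop) (ae_of_all _ fun t => ?_)
    simp only [Pi.add_apply, norm_mul, norm_pow, Real.norm_eq_abs]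
    nlinarith [abs_nonneg (h t), sq_nonneg (|t| - 1), abs_nonneg t]
  have h4 : Integrable (fun t => (2 * s * t ^ 2 - (a + 1)) * h t) (lineMeasure s a) := by
    refine ((h2.const_mul (2 * s)).sub (h0.const_mul (a + 1))).congr (ae_of_all _ fun t => ?_)
    simp only [Pi.sub_apply]; ring
  rw [← sub_eq_zero, ← integral_sub h1 h4, integral_lineMeasure hs ha]
  have hI := (integrable_lineMeasure_iff hs ha _).1 (h1.sub h4)
  simp only [Pi.sub_apply] at hI
  rw [mul_eq_zero]
  right
  refine setIntegral_ray_deriv_eq_zero ha (f := fun t => t * h t * lineWeight s a t)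
    ?_ (by simp) (fun t ht => ?_) ((integrable_lineMeasure_iff hs ha _).1 h3) hI
  · refine ContinuousAt.continuousWithinAt ?_
    refine (continuous_id.mul hcont).continuousAt.mul ?_
    exact (Real.continuousAt_rpow_const 0 a (Or.inr ha)).mul (by fun_prop)
  · refine (((hasDerivAt_id t).mul (hh t)).mul (hasDerivAt_lineWeight ha ht)).congr_deriv ?_
    have := mul_div_self_of_mem_ray ha ht
    simp only [id, Pi.mul_apply]
    linear_combination (h t * lineWeight s a t) * this

/-- The local form of the one-dimensional Poincaré inequality. With `g = h - h z` and
`q = g / (t - z)`, where `z` is the maximum point of the density, the derivative of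
`q g t ^ a e^{-s t²}` is at most `(h' ^ 2 - 2 s g ^ 2) t ^ a e^{-s t²}`, since the difference is
`(h' - q) ^ 2 + 2 s z (t - z) ^ 2 q ^ 2 / t` times the density; moreover `q g` has the sign
of `t - z`. -/
lemma intervalIntegral_poincare_nonneg {s a : ℝ} (hs : 0 < s) (ha : 0 ≤ a) {h h' : ℝ → ℝ}
    (hh : ∀ t, HasDerivAt h (h' t) t) (hc : Continuous h') {z : ℝ} (hz0 : 0 ≤ z)
    (hz : 2 * s * z ^ 2 = a) {l r : ℝ} (hl : l ≤ z) (hr : z ≤ r) (hsub : Set.Icc l r ⊆ ray a) :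
    0 ≤ ∫ t in l..r, (h' t ^ 2 - 2 * s * (h t - h z) ^ 2) * lineWeight s a t := by
  have hcont : Continuous h := continuous_iff_continuousAt.2 fun t => (hh t).continuousAt
  have hwc : ContinuousOn (lineWeight s a) (Set.Icc l r) := fun t ht =>
    (hasDerivAt_lineWeight ha (hsub ht)).continuousAt.continuousWithinAt
  have hφ : ContinuousOn (fun t => (h' t ^ 2 - 2 * s * (h t - h z) ^ 2) * lineWeight s a t)
      (Set.Icc l r) := ContinuousOn.mul (by fun_prop) hwc
  set Φ : ℝ → ℝ := fun t => (h t - h z) * dslope h z t * lineWeight s a t with hΦ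
  have hΦc : ContinuousOn Φ (Set.Icc l r) := by
    refine ContinuousOn.mul (ContinuousOn.mul (by fun_prop) ?_) hwc
    refine Continuous.continuousOn (continuous_iff_continuousAt.2 fun t => ?_)
    by_cases htz : t = z
    · subst htz
      exact continuousAt_dslope_same.2 (hh t).differentiableAt
    · exact (continuousAt_dslope_of_ne htz).2 hcont.continuousAt
  have hds : ∀ t, t ≠ z → dslope h z t = (h t - h z) / (t - z) := fun t ht => by
    rw [dslope_of_ne _ ht, slope_def_field]
  have hderiv : ∀ t ∈ Set.Icc l r, t ≠ z → HasDerivAt Φ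
      ((h' t * ((h t - h z) / (t - z)) + (h t - h z) *
          ((h' t * (t - z) - (h t - h z) * 1) / (t - z) ^ 2)) * lineWeight s a t
        + (h t - h z) * ((h t - h z) / (t - z)) *
          ((a / t - 2 * s * t) * lineWeight s a t)) t := fun t ht htz => by
    have h1 : HasDerivAt (fun t => h t - h z) (h' t) t := (hh t).sub_const _
    have h2 : HasDerivAt (fun t => t - z) 1 t := (hasDerivAt_id t).sub_const _
    refine ((h1.mul (h1.div h2 (sub_ne_zero.2 htz))).mul
      (hasDerivAt_lineWeight ha (hsub ht))).congr_of_eventuallyEq ?_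
    filter_upwards [isOpen_ne.mem_nhds htz] with y hy
    simp [hΦ, hds y hy]
  have hle : ∀ t ∈ Set.Icc l r, t ≠ z →
      (h' t * ((h t - h z) / (t - z)) + (h t - h z) *
          ((h' t * (t - z) - (h t - h z) * 1) / (t - z) ^ 2)) * lineWeight s a t
        + (h t - h z) * ((h t - h z) / (t - z)) *
          ((a / t - 2 * s * t) * lineWeight s a t)
      ≤ (h' t ^ 2 - 2 * s * (h t - h z) ^ 2) * lineWeight s a t := fun t ht htz => by
    have hw := lineWeight_pos (s := s) ha (hsub ht)
    have htz' : t - z ≠ 0 := sub_ne_zero.2 htz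
    obtain ⟨q, hq⟩ : ∃ q, q = (h t - h z) / (t - z) := ⟨_, rfl⟩
    have hg : h t - h z = q * (t - z) := by rw [hq]; field_simp
    have hzt : 0 ≤ z * (1 - z / t) * (t - z) := by
      rcases ha.eq_or_lt with rfl | ha
      · have : z = 0 := by
          have : z ^ 2 = 0 := by
            rcases mul_eq_zero.1 hz with h | h
            · linarith
            · exact h
          exact pow_eq_zero_iff (two_ne_zero) |>.1 this
        simp [this]
      · have ht0 := hsub ht ha
        have : z * (1 - z / t) * (t - z) = z * (t - z) ^ 2 / t := by field_simp
        rw [this]; positivity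
    have hat : a / t = 2 * s * z * (z / t) := by rw [← hz]; ring
    have key : (h' t * q + q * (h' t - q))
        + q * (t - z) * q * (a / t - 2 * s * t) ≤ h' t ^ 2 - 2 * s * (q * (t - z)) ^ 2 := by
      rw [hat]
      have h1 : 0 ≤ (h' t - q) ^ 2 := sq_nonneg _
      have h2 : 0 ≤ 2 * s * q ^ 2 * (z * (1 - z / t) * (t - z)) := by positivity
      linarith
    have e : (h t - h z) * ((h' t * (t - z) - (h t - h z) * 1) / (t - z) ^ 2)
        = q * (h' t - q) := by
      rw [hg]; field_simp
    rw [e, ← hq, hg]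
    calc _ = ((h' t * q + q * (h' t - q)) + q * (t - z) * q * (a / t - 2 * s * t))
          * lineWeight s a t := by ring
      _ ≤ _ := mul_le_mul_of_nonneg_right key hw.le
  have hΦz : Φ z = 0 := by simp [hΦ]
  have hL : Φ z - Φ l ≤ ∫ t in l..z,
      (h' t ^ 2 - 2 * s * (h t - h z) ^ 2) * lineWeight s a t := by
    have hs1 : Set.Icc l z ⊆ Set.Icc l r := Set.Icc_subset_Icc_right hr
    exact intervalIntegral.sub_le_integral_of_hasDeriv_right_of_le hl (hΦc.mono hs1)
      (fun t ht => (hderiv t (hs1 ⟨ht.1.le, ht.2.le⟩) ht.2.ne).hasDerivWithinAt)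
      ((hφ.mono hs1).integrableOn_Icc)
      fun t ht => hle t (hs1 ⟨ht.1.le, ht.2.le⟩) ht.2.ne
  have hR : Φ r - Φ z ≤ ∫ t in z..r,
      (h' t ^ 2 - 2 * s * (h t - h z) ^ 2) * lineWeight s a t := by
    have hs1 : Set.Icc z r ⊆ Set.Icc l r := Set.Icc_subset_Icc_left hl
    exact intervalIntegral.sub_le_integral_of_hasDeriv_right_of_le hr (hΦc.mono hs1)
      (fun t ht => (hderiv t (hs1 ⟨ht.1.le, ht.2.le⟩) ht.1.ne').hasDerivWithinAt)
      ((hφ.mono hs1).integrableOn_Icc)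
      fun t ht => hle t (hs1 ⟨ht.1.le, ht.2.le⟩) ht.1.ne'
  have hΦl : Φ l ≤ 0 := by
    rcases hl.eq_or_lt with rfl | hl'
    · exact hΦz.le
    · simp only [hΦ, hds l hl'.ne]
      refine mul_nonpos_of_nonpos_of_nonneg ?_
        (lineWeight_pos ha (hsub ⟨le_rfl, hl.trans hr⟩)).le
      rw [← mul_div_assoc]
      exact div_nonpos_of_nonneg_of_nonpos (mul_self_nonneg _) (by linarith)
  have hΦr : 0 ≤ Φ r := by
    rcases hr.eq_or_lt with rfl | hr'
    · exact hΦz.ge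
    · simp only [hΦ, hds r hr'.ne']
      refine mul_nonneg ?_ (lineWeight_pos ha (hsub ⟨hl.trans hr, le_rfl⟩)).le
      rw [← mul_div_assoc]
      exact div_nonneg (mul_self_nonneg _) (by linarith)
  have hii : ∀ {p q : ℝ}, p ∈ Set.Icc l r → q ∈ Set.Icc l r → IntervalIntegrable
      (fun t => (h' t ^ 2 - 2 * s * (h t - h z) ^ 2) * lineWeight s a t) volume p q :=
    fun hp hq => (hφ.mono (Set.uIcc_subset_Icc hp hq)).intervalIntegrable
  rw [← intervalIntegral.integral_add_adjacent_intervals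
    (hii ⟨le_rfl, hl.trans hr⟩ ⟨hl, hr⟩) (hii ⟨hl, hr⟩ ⟨hl.trans hr, le_rfl⟩)]
  linarith

/-- The Poincaré inequality, with constant `2 s`, for `t ^ a e^{-s t²} dt` on `ray a`. No boundary
condition is needed at `0`. -/
theorem variance_lineMeasure_le {s a : ℝ} (hs : 0 < s) (ha : 0 ≤ a) {h h' : ℝ → ℝ}
    (hh : ∀ t, HasDerivAt h (h' t) t) (hc : Continuous h') {C : ℝ} (hC : ∀ t, |h t| ≤ C)
    (hC' : ∀ t, |h' t| ≤ C) :
    2 * s * Var[h; lineMeasure s a] ≤ ∫ t, h' t ^ 2 ∂lineMeasure s a := by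
  have hcont : Continuous h := continuous_iff_continuousAt.2 fun t => (hh t).continuousAt
  have := isProbabilityMeasure_lineMeasure hs ha
  obtain ⟨z, hz0, hz⟩ : ∃ z : ℝ, 0 ≤ z ∧ 2 * s * z ^ 2 = a :=
    ⟨√(a / (2 * s)), Real.sqrt_nonneg _, by rw [Real.sq_sqrt (by positivity)]; field_simp⟩
  have hzpos : 0 < a → 0 < z := fun ha => by
    rcases hz0.eq_or_lt with rfl | h
    · simp at hz; linarith
    · exact h
  have hb : ∀ t, |h t - h z| ≤ 2 * C := fun t => by
    have h1 := abs_le.1 (hC t)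
    have h2 := abs_le.1 (hC z)
    exact abs_le.2 ⟨by linarith, by linarith⟩
  have i1 : Integrable (fun t => h' t ^ 2) (lineMeasure s a) :=
    integrable_of_measurable_of_bound (by fun_prop) fun t => abs_sq_le_of_bound (hC' t)
  have i2 : Integrable (fun t => 2 * s * (h t - h z) ^ 2) (lineMeasure s a) :=
    (integrable_of_measurable_of_bound (by fun_prop)
      fun t => abs_sq_le_of_bound (hb t)).const_mul _
  have hvar : Var[h; lineMeasure s a] ≤ ∫ t, (h t - h z) ^ 2 ∂lineMeasure s a := by
    rw [← variance_sub_const hcont.aestronglyMeasurable (h z)]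
    exact variance_le_expectation_sq (by fun_prop)
  have hI := (integrable_lineMeasure_iff hs ha _).1 (i1.sub i2)
  simp only [Pi.sub_apply] at hI
  have key : 0 ≤ ∫ t in ray a, (h' t ^ 2 - 2 * s * (h t - h z) ^ 2) * lineWeight s a t := by
    obtain ⟨l, r, hl, hr, hsub, hmono, hU⟩ : ∃ l r : ℕ → ℝ, (∀ n, l n ≤ z) ∧ (∀ n, z ≤ r n) ∧
        (∀ n, Set.Icc (l n) (r n) ⊆ ray a) ∧ Monotone (fun n => Set.Ioc (l n) (r n)) ∧
        ⋃ n, Set.Ioc (l n) (r n) = ray a := by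
      rcases ha.eq_or_lt with rfl | ha
      · have hz0 : z = 0 := by
          rcases mul_eq_zero.1 hz with h | h
          · linarith
          · exact (pow_eq_zero_iff two_ne_zero).1 h
        refine ⟨fun n => -n, fun n => n, fun n => by simp [hz0], fun n => by simp [hz0],
          fun n t _ => by simp [ray], fun m n hmn => ?_, ?_⟩
        · have : (m : ℝ) ≤ n := by exact_mod_cast hmn
          exact Set.Ioc_subset_Ioc (by linarith) this
        · rw [ray_zero, Set.eq_univ_iff_forall]
          intro t
          obtain ⟨n, hn⟩ := exists_nat_gt |t|
          exact Set.mem_iUnion.2 ⟨n, (abs_lt.1 hn).1, (abs_lt.1 hn).2.le⟩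
      · have hz1 := hzpos ha
        refine ⟨fun n => z / (n + 1), fun n => z + n,
          fun n => div_le_self hz0 (by simp), fun n => by simp,
          fun n t ht _ => lt_of_lt_of_le (by positivity) ht.1, fun m n hmn => ?_, ?_⟩
        · have : (m : ℝ) ≤ n := by exact_mod_cast hmn
          exact Set.Ioc_subset_Ioc (by dsimp only; gcongr) (by dsimp only; gcongr)
        · rw [ray_of_pos ha]
          refine Set.Subset.antisymm (Set.iUnion_subset fun n t ht =>
            lt_trans (by positivity) ht.1) fun t ht => ?_
          have ht0 : 0 < t := ht
          obtain ⟨n, hn⟩ := exists_nat_gt (max (z / t) t)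
          have h1 : z / t < n := (le_max_left _ _).trans_lt hn
          have h2 : t < n := (le_max_right _ _).trans_lt hn
          rw [div_lt_iff₀ ht0] at h1
          refine Set.mem_iUnion.2 ⟨n, ?_, by linarith⟩
          rw [div_lt_iff₀ (by positivity)]
          linarith
    have hT := tendsto_setIntegral_of_monotone (μ := volume) (fun n => measurableSet_Ioc) hmono
      (hU ▸ hI)
    rw [hU] at hT
    refine ge_of_tendsto' hT fun n => ?_
    rw [← intervalIntegral.integral_of_le ((hl n).trans (hr n))]
    exact intervalIntegral_poincare_nonneg hs ha hh hc hz0 hz (hl n) (hr n) (hsub n)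
  have hfin : 0 ≤ ∫ t, (h' t ^ 2 - 2 * s * (h t - h z) ^ 2) ∂lineMeasure s a := by
    rw [integral_lineMeasure hs ha]
    exact mul_nonneg (inv_nonneg.2 (lineMass_pos hs ha).le) key
  rw [integral_sub i1 i2, integral_const_mul] at hfin
  nlinarith

end Line

/-! ### The Gaussian measure on the chamber -/

section Product

variable {N : ℕ} {α : Fin N → ℝ} {s : ℝ}

/-- The product of the one-dimensional probability measures `lineMeasure s (α i)`: in coordinates,
the probability measure proportional to `x ^ A e^{-s |x|²} dx` on the chamber. -/
noncomputable def piMeasure (s : ℝ) (α : Fin N → ℝ) : Measure (Fin N → ℝ) :=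
  Measure.pi fun i => lineMeasure s (α i)

/-- The total mass of `x ^ A e^{-s |x|²} dx` on the chamber. -/
noncomputable def gaussMass (s : ℝ) (α : Fin N → ℝ) : ℝ := ∏ i, lineMass s (α i)

lemma gaussMass_pos (hs : 0 < s) (hα : ∀ i, 0 ≤ α i) : 0 < gaussMass s α :=
  Finset.prod_pos fun i _ => lineMass_pos hs (hα i)

lemma isProbabilityMeasure_piMeasure (hs : 0 < s) (hα : ∀ i, 0 ≤ α i) :
    IsProbabilityMeasure (piMeasure s α) := by
  have := fun i => isProbabilityMeasure_lineMeasure hs (hα i)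
  unfold piMeasure; infer_instance

lemma piMeasure_eq_withDensity (hs : 0 < s) (hα : ∀ i, 0 ≤ α i) :
    piMeasure s α = (volume : Measure (Fin N → ℝ)).withDensity
      fun y => ENNReal.ofReal (∏ i, lineDensity s (α i) (y i)) := by
  have := fun i => isProbabilityMeasure_lineMeasure hs (hα i)
  refine Measure.pi_eq fun S hS => ?_
  rw [withDensity_apply _ (MeasurableSet.univ_pi hS), volume_pi, Measure.restrict_pi_pi,
    ← ofReal_integral_eq_lintegral_ofReal, integral_fintype_prod_eq_prod,
    ENNReal.ofReal_prod_of_nonneg]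
  · refine Finset.prod_congr rfl fun i _ => ?_
    rw [lineMeasure, withDensity_apply _ (hS i), ofReal_integral_eq_lintegral_ofReal
      (integrable_lineDensity hs (hα i)).restrict
      (ae_of_all _ (lineDensity_nonneg hs (hα i)))]
  · exact fun i _ => integral_nonneg (lineDensity_nonneg hs (hα i))
  · exact Integrable.fintype_prod_dep fun i => (integrable_lineDensity hs (hα i)).restrict
  · exact ae_of_all _ fun y => Finset.prod_nonneg fun i _ => lineDensity_nonneg hs (hα i) _

lemma measurable_prod_lineDensity :
    Measurable fun y : Fin N → ℝ => ∏ i, lineDensity s (α i) (y i) :=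
  Finset.measurable_fun_prod _ fun i _ => (measurable_lineDensity s (α i)).comp (measurable_pi_apply i)

lemma isOpen_chamber : IsOpen (chamber α) := by
  simp only [chamber, Set.ofPred_forall]
  exact isOpen_iInter_of_finite fun i => isOpen_iInter_of_finite fun _ =>
    isOpen_lt continuous_const (by fun_prop)

lemma measurableSet_chamber : MeasurableSet (chamber α) := isOpen_chamber.measurableSet

lemma measurable_weight : Measurable (weight α) := by
  unfold weight; fun_prop

lemma weight_pos (hα : ∀ i, 0 ≤ α i) {x : EuclideanSpace ℝ (Fin N)} (hx : x ∈ chamber α) :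
    0 < weight α x := by
  refine Finset.prod_pos fun i _ => ?_
  rcases (hα i).eq_or_lt with h | h
  · simp [← h]
  · exact Real.rpow_pos_of_pos (hx i h) _

lemma prod_lineDensity (x : EuclideanSpace ℝ (Fin N)) :
    ∏ i, lineDensity s (α i) (x i)
      = (chamber α).indicator
        (fun x => weight α x * Real.exp (-s * ‖x‖ ^ 2) / gaussMass s α) x := by
  by_cases hx : x ∈ chamber α
  · have : ∀ i, lineDensity s (α i) (x i) = lineWeight s (α i) (x i) / lineMass s (α i) :=
      fun i => Set.indicator_of_mem (show x i ∈ ray (α i) from hx i) _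
    simp_rw [this]
    rw [Set.indicator_of_mem hx, Finset.prod_div_distrib, EuclideanSpace.real_norm_sq_eq,
      Finset.mul_sum, Real.exp_sum, weight, ← Finset.prod_mul_distrib]
    rfl
  · rw [Set.indicator_of_notMem hx]
    obtain ⟨i, hi⟩ := not_forall.1 hx
    exact Finset.prod_eq_zero (Finset.mem_univ i)
      (Set.indicator_of_notMem (show x i ∉ ray (α i) from hi) _)

lemma wMeasure_eq : wMeasure α = (volume : Measure (EuclideanSpace ℝ (Fin N))).withDensity
    fun x => ENNReal.ofReal ((chamber α).indicator (weight α) x) := by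
  rw [wMeasure, ← withDensity_indicator measurableSet_chamber]
  congr 1
  funext x
  by_cases hx : x ∈ chamber α <;> simp [hx]

lemma indicator_weight_nonneg (hα : ∀ i, 0 ≤ α i) (x : EuclideanSpace ℝ (Fin N)) :
    0 ≤ (chamber α).indicator (weight α) x :=
  Set.indicator_nonneg (fun _ hx => (weight_pos hα hx).le) x

lemma density_mul_eq (hs : 0 < s) (hα : ∀ i, 0 ≤ α i) (F : EuclideanSpace ℝ (Fin N) → ℝ)
    (x : EuclideanSpace ℝ (Fin N)) :
    (chamber α).indicator (weight α) x * (F x * Real.exp (-s * ‖x‖ ^ 2))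
      = gaussMass s α * ((∏ i, lineDensity s (α i) (x i)) * F x) := by
  have := (gaussMass_pos hs hα).ne'
  rw [prod_lineDensity]
  by_cases hx : x ∈ chamber α
  · simp only [Set.indicator_of_mem hx]; field_simp
  · simp [hx]

lemma integral_mul_exp_wMeasure (hs : 0 < s) (hα : ∀ i, 0 ≤ α i)
    (F : EuclideanSpace ℝ (Fin N) → ℝ) :
    ∫ x, F x * Real.exp (-s * ‖x‖ ^ 2) ∂wMeasure α
      = gaussMass s α * ∫ y, F (WithLp.toLp 2 y) ∂piMeasure s α := by
  rw [wMeasure_eq, piMeasure_eq_withDensity hs hα,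
    integral_withDensity_eq_integral_toReal_smul
      (measurable_weight.indicator measurableSet_chamber).ennreal_ofReal
      (ae_of_all _ fun _ => ENNReal.ofReal_lt_top),
    integral_withDensity_eq_integral_toReal_smul measurable_prod_lineDensity.ennreal_ofReal
      (ae_of_all _ fun _ => ENNReal.ofReal_lt_top)]
  simp_rw [ENNReal.toReal_ofReal (indicator_weight_nonneg hα _), smul_eq_mul,
    density_mul_eq hs hα, ENNReal.toReal_ofReal
    (Finset.prod_nonneg fun i _ => lineDensity_nonneg hs (hα i) _)]
  rw [integral_const_mul, ← (PiLp.volume_preserving_toLp (Fin N)).integral_comp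
    (MeasurableEquiv.toLp 2 (Fin N → ℝ)).measurableEmbedding]

lemma integrable_mul_exp_wMeasure_iff (hs : 0 < s) (hα : ∀ i, 0 ≤ α i)
    (F : EuclideanSpace ℝ (Fin N) → ℝ) :
    Integrable (fun x => F x * Real.exp (-s * ‖x‖ ^ 2)) (wMeasure α)
      ↔ Integrable (fun y => F (WithLp.toLp 2 y)) (piMeasure s α) := by
  rw [wMeasure_eq, piMeasure_eq_withDensity hs hα,
    integrable_withDensity_iff_integrable_smul'
      (measurable_weight.indicator measurableSet_chamber).ennreal_ofReal
      (ae_of_all _ fun _ => ENNReal.ofReal_lt_top),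
    integrable_withDensity_iff_integrable_smul' measurable_prod_lineDensity.ennreal_ofReal
      (ae_of_all _ fun _ => ENNReal.ofReal_lt_top)]
  simp_rw [ENNReal.toReal_ofReal (indicator_weight_nonneg hα _), smul_eq_mul,
    density_mul_eq hs hα, ENNReal.toReal_ofReal
    (Finset.prod_nonneg fun i _ => lineDensity_nonneg hs (hα i) _)]
  rw [integrable_const_mul_iff (isUnit_iff_ne_zero.2 (gaussMass_pos hs hα).ne'),
    ← (PiLp.volume_preserving_toLp (Fin N)).integrable_comp_emb
    (MeasurableEquiv.toLp 2 (Fin N → ℝ)).measurableEmbedding]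
  rfl

lemma integrable_of_le_exp (hs : 0 < s) (hα : ∀ i, 0 ≤ α i) {f : EuclideanSpace ℝ (Fin N) → ℝ}
    (hf : Measurable f) {C : ℝ} (hC : ∀ x, |f x| ≤ C * Real.exp (-s * ‖x‖ ^ 2)) :
    Integrable f (wMeasure α) := by
  have := isProbabilityMeasure_piMeasure hs hα
  have h := (integrable_mul_exp_wMeasure_iff hs hα fun _ => C).2 (integrable_const C)
  exact h.mono' hf.aestronglyMeasurable (ae_of_all _ hC)

lemma integrable_wMeasure_of_hasCompactSupport (hα : ∀ i, 0 ≤ α i)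
    {f : EuclideanSpace ℝ (Fin N) → ℝ} (hf : Continuous f) (hc : HasCompactSupport f) :
    Integrable f (wMeasure α) := by
  obtain ⟨C, hC⟩ := (hf.mul (by fun_prop : Continuous fun x : EuclideanSpace ℝ (Fin N) =>
    Real.exp (‖x‖ ^ 2))).bounded_above_of_compact_support hc.mul_right
  refine integrable_of_le_exp one_pos hα hf.measurable (C := C) fun x => ?_
  have := hC x
  rw [Pi.mul_apply, norm_mul, Real.norm_eq_abs, Real.norm_eq_abs, Real.abs_exp] at this
  rw [neg_one_mul, Real.exp_neg, ← div_eq_mul_inv, le_div_iff₀ (Real.exp_pos _)]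
  exact this

lemma gradient_apply {F : EuclideanSpace ℝ (Fin N) → ℝ} (x : EuclideanSpace ℝ (Fin N))
    (i : Fin N) : gradient F x i = fderiv ℝ F x (EuclideanSpace.single i 1) := by
  rw [← inner_gradient_left, EuclideanSpace.inner_single_right]
  simp

lemma hasDerivAt_comp_update {F : EuclideanSpace ℝ (Fin N) → ℝ} (hF : Differentiable ℝ F)
    (x : Fin N → ℝ) (i : Fin N) (t : ℝ) :
    HasDerivAt (fun t => F (WithLp.toLp 2 (Function.update x i t)))
      (gradient F (WithLp.toLp 2 (Function.update x i t)) i) t := by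
  have h1 : HasDerivAt (fun t => WithLp.toLp 2 (Function.update x i t))
      (EuclideanSpace.single i (1 : ℝ)) t :=
    (EuclideanSpace.equiv (Fin N) ℝ).symm.hasFDerivAt.comp_hasDerivAt t (hasDerivAt_update x i t)
  rw [gradient_apply]
  exact (hF _).hasFDerivAt.comp_hasDerivAt t h1

/-- Integration by parts in one coordinate against `x ^ A e^{-s |x|²} dx` on the chamber. -/
theorem integral_coord_mul_gradient (hs : 0 < s) (hα : ∀ i, 0 ≤ α i)
    {F : EuclideanSpace ℝ (Fin N) → ℝ} (hF : Differentiable ℝ F) (i : Fin N)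
    (h0 : Integrable (fun x => F x * Real.exp (-s * ‖x‖ ^ 2)) (wMeasure α))
    (h1 : Integrable (fun x => x i * gradient F x i * Real.exp (-s * ‖x‖ ^ 2)) (wMeasure α))
    (h2 : Integrable (fun x => x i ^ 2 * F x * Real.exp (-s * ‖x‖ ^ 2)) (wMeasure α)) :
    ∫ x, x i * gradient F x i * Real.exp (-s * ‖x‖ ^ 2) ∂wMeasure α
      = ∫ x, (2 * s * x i ^ 2 - (α i + 1)) * F x * Real.exp (-s * ‖x‖ ^ 2) ∂wMeasure α := by
  have := fun i => isProbabilityMeasure_lineMeasure hs (hα i)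
  have h3 : Integrable (fun x => (2 * s * x i ^ 2 - (α i + 1)) * F x * Real.exp (-s * ‖x‖ ^ 2))
      (wMeasure α) := by
    refine ((h2.const_mul (2 * s)).sub (h0.const_mul (α i + 1))).congr (ae_of_all _ fun t => ?_)
    simp only [Pi.sub_apply]; ring
  rw [integral_mul_exp_wMeasure hs hα, integral_mul_exp_wMeasure hs hα]
  rw [integrable_mul_exp_wMeasure_iff hs hα] at h0 h1 h2 h3
  unfold piMeasure at *
  rw [integral_pi_eq_integral_update h1 i, integral_pi_eq_integral_update h3 i]
  congr 1
  refine integral_congr_ae ?_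
  filter_upwards [ae_integrable_update h0 i, ae_integrable_update h1 i,
    ae_integrable_update h2 i] with y h0 h1 h2
  simp only [Function.update_self] at *
  exact integral_id_mul_deriv_lineMeasure hs (hα i) (hasDerivAt_comp_update hF y i) h0 h1 h2

/-- The Poincaré inequality for `x ^ A e^{-s |x|²} dx` on the chamber, without boundary
condition. -/
theorem exists_poincare (hs : 0 < s) (hα : ∀ i, 0 ≤ α i) {v : EuclideanSpace ℝ (Fin N) → ℝ}
    (hv : ContDiff ℝ 1 v) (hc : HasCompactSupport v) :
    ∃ c : ℝ, 2 * s * ∫ x, (v x - c) ^ 2 * Real.exp (-s * ‖x‖ ^ 2) ∂wMeasure α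
      ≤ ∫ x, ‖gradient v x‖ ^ 2 * Real.exp (-s * ‖x‖ ^ 2) ∂wMeasure α := by
  have := fun i => isProbabilityMeasure_lineMeasure hs (hα i)
  have hprob := isProbabilityMeasure_piMeasure hs hα
  have hg : ∀ i, Continuous fun x => gradient v x i := fun i => by
    simp_rw [gradient_apply]
    exact (hv.continuous_fderiv one_ne_zero).clm_apply continuous_const
  have hgc : ∀ i, HasCompactSupport fun x => gradient v x i := fun i => by
    simp_rw [gradient_apply]
    exact hc.fderiv_apply ℝ _
  obtain ⟨C₀, hC₀⟩ := hv.continuous.bounded_above_of_compact_support hc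
  choose C hC using fun i => (hg i).bounded_above_of_compact_support (hgc i)
  have htoLp : Continuous fun y : Fin N → ℝ => (WithLp.toLp 2 y : EuclideanSpace ℝ (Fin N)) :=
    PiLp.continuous_toLp 2 _
  set V : (Fin N → ℝ) → ℝ := fun y => v (WithLp.toLp 2 y) with hV
  have hVm : Measurable V := (hv.continuous.comp htoLp).measurable
  have hgm : ∀ i, Measurable fun y : Fin N → ℝ => gradient v (WithLp.toLp 2 y) i :=
    fun i => ((hg i).comp htoLp).measurable
  have hgi : ∀ i, Integrable (fun y : Fin N → ℝ => gradient v (WithLp.toLp 2 y) i ^ 2)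
      (piMeasure s α) := fun i =>
    integrable_of_measurable_of_bound ((hgm i).pow_const 2) fun y => abs_sq_le_of_bound (hC i _)
  refine ⟨∫ y, V y ∂piMeasure s α, ?_⟩
  rw [integral_mul_exp_wMeasure hs hα, integral_mul_exp_wMeasure hs hα, mul_left_comm]
  refine mul_le_mul_of_nonneg_left ?_ (gaussMass_pos hs hα).le
  rw [← variance_eq_integral hVm.aemeasurable]
  have hES : Var[V; piMeasure s α] ≤
      ∑ i, ∫ x, Var[fun t => V (Function.update x i t); lineMeasure s (α i)] ∂piMeasure s α :=
    variance_pi_le _ hVm fun y => hC₀ _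
  simp_rw [EuclideanSpace.real_norm_sq_eq]
  rw [integral_finsetSum _ fun i _ => hgi i]
  refine (mul_le_mul_of_nonneg_left hES (by positivity)).trans ?_
  rw [Finset.mul_sum]
  refine Finset.sum_le_sum fun i _ => ?_
  have hslice : ∀ x : Fin N → ℝ,
      2 * s * Var[fun t => V (Function.update x i t); lineMeasure s (α i)]
      ≤ ∫ t, gradient v (WithLp.toLp 2 (Function.update x i t)) i ^ 2 ∂lineMeasure s (α i) :=
    fun x => variance_lineMeasure_le hs (hα i) (hasDerivAt_comp_update
      (hv.differentiable one_ne_zero) x i)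
      ((hg i).comp (htoLp.comp (continuous_const.update i continuous_id)))
      (C := max C₀ (C i)) (fun t => (hC₀ _).trans (le_max_left _ _))
      (fun t => (hC i _).trans (le_max_right _ _))
  rw [← integral_const_mul]
  refine (integral_mono ?_ ?_ hslice).trans_eq ?_
  · refine Integrable.const_mul (integrable_of_measurable_of_bound (C := C₀ ^ 2) ?_ fun y => ?_) _
    · exact measurable_variance_right (F := fun p : (Fin N → ℝ) × ℝ =>
        V (Function.update p.1 i p.2)) (hVm.comp (measurable_update_prod i)) fun p => hC₀ _
    · exact abs_variance_le_sq_of_bound (f := fun t => V (Function.update y i t))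
        (hVm.comp (measurable_update y)) fun t => hC₀ _
  · refine integrable_of_measurable_of_bound (C := C i ^ 2) ?_ fun y =>
      abs_integral_le_of_bound fun t => abs_sq_le_of_bound (hC i _)
    exact measurable_integral_right (F := fun p : (Fin N → ℝ) × ℝ =>
        gradient v (WithLp.toLp 2 (Function.update p.1 i p.2)) i ^ 2)
        (((hgm i).comp (measurable_update_prod i)).pow_const 2)
  · exact (integral_pi_eq_integral_update (hgi i) i).symm

end Product

/-! ### The stability inequality for test functions -/

section TestFunctions

variable {N : ℕ} {α : Fin N → ℝ} {s : ℝ}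

lemma hasGradientAt_mul_radial {φ : EuclideanSpace ℝ (Fin N) → ℝ} {x : EuclideanSpace ℝ (Fin N)}
    (hφ : DifferentiableAt ℝ φ x) {f : ℝ → ℝ} {f' : ℝ} (hf : HasDerivAt f f' (‖x‖ ^ 2)) :
    HasGradientAt (fun y => φ y * f (‖y‖ ^ 2))
      (f (‖x‖ ^ 2) • gradient φ x + (2 * φ x * f') • x) x := by
  rw [hasGradientAt_iff_hasFDerivAt]
  have h1 := hf.comp_hasFDerivAt x (hasStrictFDerivAt_norm_sq x).hasFDerivAt
  refine (hφ.hasFDerivAt.mul h1).congr_fderiv ?_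
  ext y
  simp
  ring

lemma hasDerivAt_exp_const_mul (c r : ℝ) :
    HasDerivAt (fun r => Real.exp (c * r)) (c * Real.exp (c * r)) r := by
  simpa [mul_comm] using ((hasDerivAt_id r).const_mul c).exp

lemma gradient_mul_exp {φ : EuclideanSpace ℝ (Fin N) → ℝ} (hφ : Differentiable ℝ φ) (c : ℝ)
    (x : EuclideanSpace ℝ (Fin N)) :
    gradient (fun y => φ y * Real.exp (c * ‖y‖ ^ 2)) x
      = Real.exp (c * ‖x‖ ^ 2) • (gradient φ x + (2 * c * φ x) • x) := by
  rw [(hasGradientAt_mul_radial (hφ x) (hasDerivAt_exp_const_mul c _)).gradient, smul_add,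
    smul_smul]
  congr 2
  ring

/-- Integration by parts in one coordinate against `x ^ A dx` on the chamber. -/
theorem integral_coord_mul_gradient_wMeasure (hα : ∀ i, 0 ≤ α i)
    {f : EuclideanSpace ℝ (Fin N) → ℝ} (hf : Differentiable ℝ f) (i : Fin N)
    (h0 : Integrable f (wMeasure α))
    (h1 : Integrable (fun x => x i * gradient f x i) (wMeasure α))
    (h2 : Integrable (fun x => x i ^ 2 * f x) (wMeasure α)) :
    ∫ x, x i * gradient f x i ∂wMeasure α = -(α i + 1) * ∫ x, f x ∂wMeasure α := by
  -- the Gaussian version, applied to `f e^{|x|²}`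
  have hexp : ∀ x : EuclideanSpace ℝ (Fin N),
      Real.exp (1 * ‖x‖ ^ 2) * Real.exp (-1 * ‖x‖ ^ 2) = 1 := fun x => by
    rw [← Real.exp_add]; simp
  have e0 : ∀ x, (f x * Real.exp (1 * ‖x‖ ^ 2)) * Real.exp (-1 * ‖x‖ ^ 2) = f x := fun x => by
    rw [mul_assoc, hexp, mul_one]
  have e1 : ∀ x, x i * gradient (fun y => f y * Real.exp (1 * ‖y‖ ^ 2)) x i
      * Real.exp (-1 * ‖x‖ ^ 2) = x i * gradient f x i + 2 * (x i ^ 2 * f x) := fun x => by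
    rw [gradient_mul_exp hf]
    simp only [PiLp.smul_apply, PiLp.add_apply, smul_eq_mul]
    linear_combination (x i * (gradient f x i + 2 * 1 * f x * x i)) * hexp x
  have e2 : ∀ x : EuclideanSpace ℝ (Fin N), x i ^ 2 * (f x * Real.exp (1 * ‖x‖ ^ 2))
      * Real.exp (-1 * ‖x‖ ^ 2) = x i ^ 2 * f x := fun x => by
    rw [mul_assoc, e0]
  have e3 : ∀ x : EuclideanSpace ℝ (Fin N),
      (2 * 1 * x i ^ 2 - (α i + 1)) * (f x * Real.exp (1 * ‖x‖ ^ 2))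
      * Real.exp (-1 * ‖x‖ ^ 2) = 2 * (x i ^ 2 * f x) - (α i + 1) * f x := fun x => by
    rw [mul_assoc, e0]; ring
  have hdiff : Differentiable ℝ fun x : EuclideanSpace ℝ (Fin N) =>
      f x * Real.exp (1 * ‖x‖ ^ 2) := hf.mul (((differentiable_id.norm_sq ℝ).const_mul _).exp)
  have key := integral_coord_mul_gradient one_pos hα hdiff i
    (by simpa only [e0] using h0) (by simp only [e1]; exact h1.add (h2.const_mul 2))
    (by simpa only [e2] using h2)
  simp only [e1, e3] at key
  rw [integral_add h1 (h2.const_mul 2), integral_sub (h2.const_mul 2) (h0.const_mul _),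
    integral_const_mul, integral_const_mul] at key
  linarith

variable {φ : EuclideanSpace ℝ (Fin N) → ℝ}

lemma continuous_gradient (hφ : ContDiff ℝ 1 φ) : Continuous (gradient φ) :=
  (InnerProductSpace.toDual ℝ _).symm.continuous.comp (hφ.continuous_fderiv one_ne_zero)

lemma hasCompactSupport_gradient (hc : HasCompactSupport φ) : HasCompactSupport (gradient φ) :=
  (hc.fderiv ℝ).comp_left (map_zero (InnerProductSpace.toDual ℝ _).symm)

/-- The dilation identity `∫ 2 φ (x · ∇φ) x ^ A = -D ∫ φ² x ^ A`. -/
lemma integral_two_mul_inner_gradient (hα : ∀ i, 0 ≤ α i) (hφ : ContDiff ℝ 1 φ)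
    (hc : HasCompactSupport φ) :
    ∫ x, 2 * φ x * inner ℝ x (gradient φ x) ∂wMeasure α
      = -homDim α * ∫ x, φ x ^ 2 ∂wMeasure α := by
  have hd : Differentiable ℝ φ := hφ.differentiable one_ne_zero
  have hgc := continuous_gradient hφ
  have hgi : ∀ i, Continuous fun x => gradient φ x i := fun i => by fun_prop
  have hcont := hφ.continuous
  have hc2 : HasCompactSupport fun x => φ x ^ 2 := by
    simpa [sq] using! hc.mul_right (f' := φ)
  have hgrad : ∀ x i, gradient (fun x => φ x ^ 2) x i = 2 * φ x * gradient φ x i := fun x i => by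
    rw [gradient_apply, gradient_apply, ((hd x).hasFDerivAt.pow 2).fderiv]
    simp
  have hs : ∀ x, 2 * φ x * inner ℝ x (gradient φ x)
      = ∑ i, x i * gradient (fun x => φ x ^ 2) x i := fun x => by
    simp_rw [hgrad]
    rw [PiLp.inner_apply, Finset.mul_sum]
    refine Finset.sum_congr rfl fun i _ => ?_
    simp
    ring
  have h1 : ∀ i, Integrable (fun x => x i * gradient (fun x => φ x ^ 2) x i) (wMeasure α) :=
    fun i => by
      simp_rw [hgrad]
      refine integrable_wMeasure_of_hasCompactSupport hα (by have := hgi i; fun_prop) ?_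
      exact ((hc.mul_left (f := fun _ => 2)).mul_right).mul_left
  simp_rw [hs]
  rw [integral_finsetSum _ fun i _ => h1 i]
  have h2 : ∀ i, ∫ x, x i * gradient (fun x => φ x ^ 2) x i ∂wMeasure α
      = -(α i + 1) * ∫ x, φ x ^ 2 ∂wMeasure α := fun i =>
    integral_coord_mul_gradient_wMeasure hα (hd.pow 2) i
      (integrable_wMeasure_of_hasCompactSupport hα (by fun_prop) hc2) (h1 i)
      (integrable_wMeasure_of_hasCompactSupport hα (by fun_prop) hc2.mul_left)
  simp_rw [h2]
  rw [← Finset.sum_mul]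
  congr 1
  simp only [neg_add_rev, Finset.sum_add_distrib, Finset.sum_neg_distrib, Finset.sum_const,
    Finset.card_univ, Fintype.card_fin, nsmul_eq_mul, homDim]
  ring

/-- The energy identity behind the uncertainty principle. -/
lemma integral_norm_gradient_add_sq (hα : ∀ i, 0 ≤ α i) (hφ : ContDiff ℝ 1 φ)
    (hc : HasCompactSupport φ) (s : ℝ) :
    ∫ x, ‖gradient φ x + (s * φ x) • x‖ ^ 2 ∂wMeasure α
      = ∫ x, ‖gradient φ x‖ ^ 2 ∂wMeasure α + s ^ 2 * ∫ x, φ x ^ 2 * ‖x‖ ^ 2 ∂wMeasure α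
        - s * homDim α * ∫ x, φ x ^ 2 ∂wMeasure α := by
  have hgc := continuous_gradient hφ
  have hcont := hφ.continuous
  have hexp : ∀ x, ‖gradient φ x + (s * φ x) • x‖ ^ 2 = ‖gradient φ x‖ ^ 2
      + s * (2 * φ x * inner ℝ x (gradient φ x)) + s ^ 2 * (φ x ^ 2 * ‖x‖ ^ 2) := fun x => by
    rw [norm_add_sq_real, norm_smul, inner_smul_right, real_inner_comm, mul_pow,
      Real.norm_eq_abs, sq_abs]
    ring
  have hc2 : HasCompactSupport fun x => φ x ^ 2 := by
    simpa [sq] using! hc.mul_right (f' := φ)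
  have hg2 : HasCompactSupport fun x => ‖gradient φ x‖ ^ 2 :=
    (hasCompactSupport_gradient hc).comp_left (g := fun y => ‖y‖ ^ 2) (by simp)
  have i1 : Integrable (fun x => ‖gradient φ x‖ ^ 2) (wMeasure α) :=
    integrable_wMeasure_of_hasCompactSupport hα (by fun_prop) hg2
  have i2 : Integrable (fun x => 2 * φ x * inner ℝ x (gradient φ x)) (wMeasure α) :=
    integrable_wMeasure_of_hasCompactSupport hα (by fun_prop)
      (hc.mul_left (f := fun _ => 2)).mul_right
  have i3 : Integrable (fun x => φ x ^ 2 * ‖x‖ ^ 2) (wMeasure α) :=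
    integrable_wMeasure_of_hasCompactSupport hα (by fun_prop) hc2.mul_right
  have i4 : Integrable (fun x => ‖gradient φ x‖ ^ 2
      + s * (2 * φ x * inner ℝ x (gradient φ x))) (wMeasure α) := i1.add (i2.const_mul s)
  simp_rw [hexp]
  rw [integral_add i4 (i3.const_mul _), integral_add i1 (i2.const_mul s),
    integral_const_mul, integral_const_mul, integral_two_mul_inner_gradient hα hφ hc]
  ring

/-- The scale-dependent stability inequality for test functions: with `v = φ e^{s |x|² / 2}`, the
right-hand side is `∫ |∇v|² e^{-s |x|²} x ^ A`, and the Poincaré inequality applies to `v`. -/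
theorem exists_gaussian_stability (hs : 0 < s) (hα : ∀ i, 0 ≤ α i) (hφ : ContDiff ℝ 1 φ)
    (hc : HasCompactSupport φ) :
    ∃ c : ℝ, 2 * s * ∫ x, (φ x - c * Real.exp (-(s / 2) * ‖x‖ ^ 2)) ^ 2 ∂wMeasure α
      ≤ ∫ x, ‖gradient φ x‖ ^ 2 ∂wMeasure α + s ^ 2 * ∫ x, φ x ^ 2 * ‖x‖ ^ 2 ∂wMeasure α
        - s * homDim α * ∫ x, φ x ^ 2 ∂wMeasure α := by
  have hv : ContDiff ℝ 1 fun x => φ x * Real.exp (s / 2 * ‖x‖ ^ 2) :=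
    hφ.mul ((contDiff_const.mul (contDiff_norm_sq ℝ)).exp)
  obtain ⟨c, h⟩ := exists_poincare hs hα hv hc.mul_right
  refine ⟨c, ?_⟩
  have hexp : ∀ x : EuclideanSpace ℝ (Fin N),
      Real.exp (s / 2 * ‖x‖ ^ 2) * Real.exp (-(s / 2) * ‖x‖ ^ 2) = 1 := fun x => by
    rw [← Real.exp_add]; simp
  have hexp2 : ∀ x : EuclideanSpace ℝ (Fin N),
      Real.exp (-s * ‖x‖ ^ 2) = Real.exp (-(s / 2) * ‖x‖ ^ 2) ^ 2 := fun x => by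
    rw [← Real.exp_nat_mul]; congr 1; push_cast; ring
  have e1 : ∀ x, (φ x * Real.exp (s / 2 * ‖x‖ ^ 2) - c) ^ 2 * Real.exp (-s * ‖x‖ ^ 2)
      = (φ x - c * Real.exp (-(s / 2) * ‖x‖ ^ 2)) ^ 2 := fun x => by
    rw [hexp2, ← mul_pow, sub_mul, mul_assoc, hexp, mul_one]
  have e2 : ∀ x, ‖gradient (fun x => φ x * Real.exp (s / 2 * ‖x‖ ^ 2)) x‖ ^ 2
      * Real.exp (-s * ‖x‖ ^ 2) = ‖gradient φ x + (s * φ x) • x‖ ^ 2 := fun x => by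
    rw [gradient_mul_exp (hφ.differentiable one_ne_zero), norm_smul, Real.norm_eq_abs,
      Real.abs_exp, hexp2, ← mul_pow, mul_right_comm, hexp, one_mul,
      show 2 * (s / 2) * φ x = s * φ x by ring]
  simp_rw [e1, e2] at h
  rwa [integral_norm_gradient_add_sq hα hφ hc] at h

end TestFunctions

/-! ### Square-integrable functions -/

section LTwo

variable {X E : Type*} [MeasurableSpace X] {μ : Measure X} [NormedAddCommGroup E]

lemma integral_norm_sq_eq_eLpNorm {f : X → E} (hf : MemLp f 2 μ) :
    ∫ x, ‖f x‖ ^ 2 ∂μ = (eLpNorm f 2 μ).toReal ^ 2 := by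
  have h0 : 0 ≤ ∫ x, ‖f x‖ ^ 2 ∂μ := integral_nonneg fun x => by positivity
  rw [hf.eLpNorm_eq_integral_rpow_norm two_ne_zero ENNReal.ofNat_ne_top]
  simp only [ENNReal.toReal_ofNat, Real.rpow_ofNat]
  rw [ENNReal.toReal_ofReal (Real.rpow_nonneg h0 _), ← Real.rpow_natCast, ← Real.rpow_mul h0]
  norm_num

lemma sqrt_integral_norm_sq {f : X → E} (hf : MemLp f 2 μ) :
    √(∫ x, ‖f x‖ ^ 2 ∂μ) = (eLpNorm f 2 μ).toReal := by
  rw [integral_norm_sq_eq_eLpNorm hf, Real.sqrt_sq ENNReal.toReal_nonneg]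

lemma lintegral_enorm_sq_eq_eLpNorm (f : X → E) :
    ∫⁻ x, ‖f x‖ₑ ^ 2 ∂μ = eLpNorm f 2 μ ^ 2 := by
  have := eLpNorm_nnreal_pow_eq_lintegral (μ := μ) (f := f) (p := 2) two_ne_zero
  simpa using this.symm

lemma tendsto_eLpNorm_of_lintegral {f : ℕ → X → E}
    (h : Tendsto (fun n => ∫⁻ x, ‖f n x‖ₑ ^ 2 ∂μ) atTop (𝓝 0)) :
    Tendsto (fun n => eLpNorm (f n) 2 μ) atTop (𝓝 0) := by
  have h1 := (ENNReal.continuous_rpow_const (y := 1 / 2)).tendsto 0 |>.comp h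
  rw [ENNReal.zero_rpow_of_pos (by norm_num)] at h1
  refine h1.congr fun n => ?_
  rw [Function.comp_apply, lintegral_enorm_sq_eq_eLpNorm, ← ENNReal.rpow_natCast,
    ← ENNReal.rpow_mul]
  norm_num

lemma memLp_of_tendsto {f : ℕ → X → E} {g : X → E} (hf : ∀ n, MemLp (f n) 2 μ)
    (hg : AEStronglyMeasurable g μ)
    (h : Tendsto (fun n => eLpNorm (f n - g) 2 μ) atTop (𝓝 0)) : MemLp g 2 μ := by
  obtain ⟨n, hn⟩ := (h.eventually (gt_mem_nhds ENNReal.zero_lt_top)).exists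
  have : g = f n - (f n - g) := by abel
  rw [this]
  exact (hf n).sub ⟨(hf n).aestronglyMeasurable.sub hg, hn⟩

lemma tendsto_integral_norm_sq {f : ℕ → X → E} {g : X → E} (hf : ∀ n, MemLp (f n) 2 μ)
    (hg : MemLp g 2 μ) (h : Tendsto (fun n => eLpNorm (f n - g) 2 μ) atTop (𝓝 0)) :
    Tendsto (fun n => ∫ x, ‖f n x‖ ^ 2 ∂μ) atTop (𝓝 (∫ x, ‖g x‖ ^ 2 ∂μ)) := by
  have h1 := ((Lp.tendsto_Lp_iff_tendsto_eLpNorm'' f hf g hg).2 h).norm.pow 2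
  simp only [Lp.norm_toLp] at h1
  simpa only [integral_norm_sq_eq_eLpNorm (hf _), integral_norm_sq_eq_eLpNorm hg] using h1

end LTwo

/-! ### Passage to the completion -/

section Completion

variable {N : ℕ} {α : Fin N → ℝ}

lemma homDim_pos (hN : 1 ≤ N) (hα : ∀ i, 0 ≤ α i) : 0 < homDim α := by
  have : (1 : ℝ) ≤ N := by exact_mod_cast hN
  have := Finset.sum_nonneg fun i (_ : i ∈ Finset.univ) => hα i
  unfold homDim; linarith

lemma memLp_two_of_hasCompactSupport {E : Type*} [NormedAddCommGroup E]
    [SecondCountableTopology E]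
    (hα : ∀ i, 0 ≤ α i) {f : EuclideanSpace ℝ (Fin N) → E} (hf : Continuous f)
    (hc : HasCompactSupport f) : MemLp f 2 (wMeasure α) := by
  rw [memLp_two_iff_integrable_sq_norm hf.aestronglyMeasurable]
  exact integrable_wMeasure_of_hasCompactSupport hα (by fun_prop)
    (hc.comp_left (g := fun y => ‖y‖ ^ 2) (by simp))

lemma integral_norm_mul_sq (f : EuclideanSpace ℝ (Fin N) → ℝ) :
    ∫ x, f x ^ 2 * ‖x‖ ^ 2 ∂wMeasure α = ∫ x, ‖‖x‖ * f x‖ ^ 2 ∂wMeasure α := by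
  congr 1; funext x
  rw [norm_mul, norm_norm, Real.norm_eq_abs, mul_pow, sq_abs, mul_comm]

/-- The weak uncertainty principle for test functions, in a form that passes to limits. -/
lemma sqrt_homDim_mul_eLpNorm_le (hα : ∀ i, 0 ≤ α i) {ψ : EuclideanSpace ℝ (Fin N) → ℝ}
    (hψ : ContDiff ℝ 1 ψ) (hc : HasCompactSupport ψ) :
    ENNReal.ofReal √(homDim α) * eLpNorm ψ 2 (wMeasure α)
      ≤ eLpNorm (gradient ψ) 2 (wMeasure α)
        + eLpNorm (fun x => ‖x‖ * ψ x) 2 (wMeasure α) := by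
  have hcont := hψ.continuous
  have m1 := memLp_two_of_hasCompactSupport hα hψ.continuous hc
  have m2 := memLp_two_of_hasCompactSupport hα (continuous_gradient hψ)
    (hasCompactSupport_gradient hc)
  have m3 := memLp_two_of_hasCompactSupport (f := fun x => ‖x‖ * ψ x) hα (by fun_prop) hc.mul_left
  have h := integral_norm_gradient_add_sq hα hψ hc 1
  have h0 : 0 ≤ ∫ x, ‖gradient ψ x + (1 * ψ x) • x‖ ^ 2 ∂wMeasure α :=
    integral_nonneg fun x => by positivity
  have e : ∫ x, ψ x ^ 2 ∂wMeasure α = ∫ x, ‖ψ x‖ ^ 2 ∂wMeasure α := by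
    simp only [Real.norm_eq_abs, sq_abs]
  rw [h, integral_norm_mul_sq, e, integral_norm_sq_eq_eLpNorm m1, integral_norm_sq_eq_eLpNorm m2,
    integral_norm_sq_eq_eLpNorm m3] at h0
  rw [← ENNReal.ofReal_toReal m1.eLpNorm_ne_top, ← ENNReal.ofReal_toReal m2.eLpNorm_ne_top,
    ← ENNReal.ofReal_toReal m3.eLpNorm_ne_top, ← ENNReal.ofReal_mul (Real.sqrt_nonneg _),
    ← ENNReal.ofReal_add ENNReal.toReal_nonneg ENNReal.toReal_nonneg]
  refine ENNReal.ofReal_le_ofReal ?_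
  obtain ⟨a, ha⟩ : ∃ a, a = (eLpNorm (gradient ψ) 2 (wMeasure α)).toReal := ⟨_, rfl⟩
  obtain ⟨b, hb⟩ : ∃ b, b = (eLpNorm (fun x => ‖x‖ * ψ x) 2 (wMeasure α)).toReal := ⟨_, rfl⟩
  obtain ⟨m, hm⟩ : ∃ m, m = (eLpNorm ψ 2 (wMeasure α)).toReal := ⟨_, rfl⟩
  have ha0 : 0 ≤ a := ha ▸ ENNReal.toReal_nonneg
  have hb0 : 0 ≤ b := hb ▸ ENNReal.toReal_nonneg
  have hm0 : 0 ≤ m := hm ▸ ENNReal.toReal_nonneg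
  rw [← ha, ← hb, ← hm] at h0
  rw [← ha, ← hb, ← hm]
  rw [← Real.sqrt_sq hm0, ← Real.sqrt_mul' _ (sq_nonneg m)]
  refine Real.sqrt_le_iff.2 ⟨by positivity, ?_⟩
  nlinarith [mul_nonneg ha0 hb0]

lemma ae_ne_zero_wMeasure (hN : 1 ≤ N) : ∀ᵐ x ∂wMeasure α, x ≠ 0 := by
  have : Nonempty (Fin N) := ⟨⟨0, hN⟩⟩
  exact ((withDensity_absolutelyContinuous _ _).trans
    Measure.restrict_le_self.absolutelyContinuous).ae_le (Measure.ae_ne volume 0)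

lemma IsNeumannTest.contDiff_one {φ : EuclideanSpace ℝ (Fin N) → ℝ} (h : IsNeumannTest α φ) :
    ContDiff ℝ 1 φ := h.smooth.of_le (by exact_mod_cast le_top)

/-- Along an approximating sequence, the functions converge in `L²` as well: their differences are
controlled by the weak uncertainty principle, and Fatou's lemma along an almost everywhere
convergent subsequence identifies the limit. -/
lemma tendsto_eLpNorm_of_approx (hN : 1 ≤ N) (hα : ∀ i, 0 ≤ α i)
    {u : EuclideanSpace ℝ (Fin N) → ℝ} {G : EuclideanSpace ℝ (Fin N) → EuclideanSpace ℝ (Fin N)}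
    (hu : AEStronglyMeasurable u (wMeasure α)) (hG : AEStronglyMeasurable G (wMeasure α))
    {φ : ℕ → EuclideanSpace ℝ (Fin N) → ℝ} (hφ : ∀ n, IsNeumannTest α (φ n))
    (hA : Tendsto (fun n => eLpNorm (gradient (φ n) - G) 2 (wMeasure α)) atTop (𝓝 0))
    (hB : Tendsto (fun n => eLpNorm ((fun x => ‖x‖ * φ n x) - fun x => ‖x‖ * u x) 2
      (wMeasure α)) atTop (𝓝 0)) :
    Tendsto (fun n => eLpNorm (φ n - u) 2 (wMeasure α)) atTop (𝓝 0) := by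
  have hD := homDim_pos hN hα
  have hcont : ∀ n, Continuous (φ n) := fun n => (hφ n).smooth.continuous
  have hgm : ∀ n, AEStronglyMeasurable (gradient (φ n)) (wMeasure α) := fun n =>
    (continuous_gradient (hφ n).contDiff_one).aestronglyMeasurable
  have hxm : AEStronglyMeasurable (fun x : EuclideanSpace ℝ (Fin N) => ‖x‖) (wMeasure α) :=
    continuous_norm.aestronglyMeasurable
  have hbm : ∀ n, AEStronglyMeasurable (fun x => ‖x‖ * φ n x) (wMeasure α) := fun n =>
    hxm.mul (hcont n).aestronglyMeasurable
  have hbu : AEStronglyMeasurable (fun x => ‖x‖ * u x) (wMeasure α) := hxm.mul hu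
  obtain ⟨ns, hns, hae⟩ := (tendstoInMeasure_of_tendsto_eLpNorm two_ne_zero hbm hbu
    hB).exists_seq_tendsto_ae
  have hae' : ∀ᵐ x ∂wMeasure α, Tendsto (fun k => φ (ns k) x) atTop (𝓝 (u x)) := by
    filter_upwards [hae, ae_ne_zero_wMeasure hN] with x hx hx0
    have hx0' : ‖x‖ ≠ 0 := norm_ne_zero_iff.2 hx0
    simpa [hx0'] using hx.const_mul ‖x‖⁻¹
  set a : ℕ → ℝ≥0∞ := fun n => eLpNorm (gradient (φ n) - G) 2 (wMeasure α) with ha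
  set b : ℕ → ℝ≥0∞ := fun n => eLpNorm ((fun x => ‖x‖ * φ n x) - fun x => ‖x‖ * u x) 2
    (wMeasure α) with hb
  set κ : ℝ≥0∞ := ENNReal.ofReal √(homDim α) with hκ
  have hκ0 : κ ≠ 0 := (ENNReal.ofReal_pos.2 (Real.sqrt_pos.2 hD)).ne'
  have hκt : κ ≠ ⊤ := ENNReal.ofReal_ne_top
  have hpair : ∀ n m, eLpNorm (φ n - φ m) 2 (wMeasure α)
      ≤ κ⁻¹ * ((a n + a m) + (b n + b m)) := fun n m => by
    have h1 := sqrt_homDim_mul_eLpNorm_le (ψ := φ n - φ m) hα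
      ((hφ n).contDiff_one.sub (hφ m).contDiff_one)
      ((hφ n).compactSupport.sub (hφ m).compactSupport)
    have e1 : gradient (φ n - φ m) = (gradient (φ n) - G) - (gradient (φ m) - G) := by
      funext x
      simp only [gradient, Pi.sub_apply]
      rw [fderiv_sub ((hφ n).contDiff_one.differentiable one_ne_zero x)
        ((hφ m).contDiff_one.differentiable one_ne_zero x), map_sub]
      abel
    have e2 : (fun x => ‖x‖ * (φ n - φ m) x) = ((fun x => ‖x‖ * φ n x) - fun x => ‖x‖ * u x)
        - ((fun x => ‖x‖ * φ m x) - fun x => ‖x‖ * u x) := by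
      funext x
      simp only [Pi.sub_apply]; ring
    have h2 : κ * eLpNorm (φ n - φ m) 2 (wMeasure α) ≤ (a n + a m) + (b n + b m) := by
      refine h1.trans (add_le_add ?_ ?_)
      · rw [e1]
        exact eLpNorm_sub_le ((hgm n).sub hG) ((hgm m).sub hG) one_le_two
      · rw [e2]
        exact eLpNorm_sub_le ((hbm n).sub hbu) ((hbm m).sub hbu) one_le_two
    rwa [ENNReal.mul_le_iff_le_inv hκ0 hκt] at h2
  have hlim : ∀ n, eLpNorm (φ n - u) 2 (wMeasure α) ≤ κ⁻¹ * (a n + b n) := fun n => by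
    have h1 : eLpNorm (φ n - u) 2 (wMeasure α)
        ≤ atTop.liminf fun k => eLpNorm (φ n - φ (ns k)) 2 (wMeasure α) := by
      refine Lp.eLpNorm_lim_le_liminf_eLpNorm
        (fun k => ((hcont n).sub (hcont _)).aestronglyMeasurable) _ ?_
      filter_upwards [hae'] with x hx
      exact hx.const_sub (φ n x)
    have h2 : Tendsto (fun k => κ⁻¹ * ((a n + a (ns k)) + (b n + b (ns k)))) atTop
        (𝓝 (κ⁻¹ * ((a n + 0) + (b n + 0)))) := by
      refine ENNReal.Tendsto.const_mul ?_ (Or.inr (ENNReal.inv_ne_top.2 hκ0))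
      exact (tendsto_const_nhds.add (hA.comp hns.tendsto_atTop)).add
        (tendsto_const_nhds.add (hB.comp hns.tendsto_atTop))
    rw [add_zero, add_zero] at h2
    rw [← h2.liminf_eq]
    exact h1.trans (liminf_le_liminf (Eventually.of_forall fun k => hpair n (ns k)))
  refine tendsto_of_tendsto_of_tendsto_of_le_of_le tendsto_const_nhds ?_ (fun _ => zero_le) hlim
  have h3 : Tendsto (fun n => κ⁻¹ * (a n + b n)) atTop (𝓝 (κ⁻¹ * (0 + 0))) :=
    ENNReal.Tendsto.const_mul (hA.add hB) (Or.inr (ENNReal.inv_ne_top.2 hκ0))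
  simpa using h3

lemma memLp_gaussian (hα : ∀ i, 0 ≤ α i) {b : ℝ} (hb : 0 < b) (c : ℝ) :
    MemLp (fun x : EuclideanSpace ℝ (Fin N) => c * Real.exp (-b * ‖x‖ ^ 2)) 2 (wMeasure α) := by
  rw [memLp_two_iff_integrable_sq (by fun_prop)]
  refine integrable_of_le_exp (s := 2 * b) (C := c ^ 2) (by positivity) hα (by fun_prop) fun x => ?_
  rw [abs_of_nonneg (sq_nonneg _), mul_pow, ← Real.exp_nat_mul]
  refine le_of_eq ?_
  congr 2
  push_cast; ring

lemma distGaussians_nonneg (u : EuclideanSpace ℝ (Fin N) → ℝ) : 0 ≤ distGaussians α u :=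
  Real.iInf_nonneg fun _ => Real.sqrt_nonneg _

lemma distGaussians_le (u : EuclideanSpace ℝ (Fin N) → ℝ) {s : ℝ} (hs : 0 < s) (c : ℝ) :
    distGaussians α u
      ≤ √(∫ x, |u x - c * Real.exp (-(s / 2) * ‖x‖ ^ 2)| ^ 2 ∂wMeasure α) := by
  have hl : (1 / √s) ≠ 0 := by positivity
  have h := ciInf_le (f := fun p : ℝ × {l : ℝ // l ≠ 0} =>
    √(∫ x, |u x - p.1 * Real.exp (-(1 / (2 * (p.2 : ℝ) ^ 2)) * ‖x‖ ^ 2)| ^ 2 ∂wMeasure α))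
    ⟨0, by rintro _ ⟨p, rfl⟩; exact Real.sqrt_nonneg _⟩ (c, ⟨1 / √s, hl⟩)
  have e : 1 / (2 * (1 / √s) ^ 2) = s / 2 := by
    rw [div_pow, Real.sq_sqrt hs.le]; field_simp
  unfold distGaussians
  simpa only [e] using h

/-- Optimisation over the scale. If exactly one of `A` and `B` is `0`, the infimum over `s` is
not attained. -/
lemma le_two_mul_of_forall_scale {A B C : ℝ} (hA : 0 ≤ A) (hB : 0 ≤ B)
    (h : ∀ s : ℝ, 0 < s → C ≤ A ^ 2 / s + s * B ^ 2) : C ≤ 2 * (A * B) := by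
  have h1 : ∀ ε : ℝ, 0 < ε → C ≤ 2 * (A * B) + ε * (A + B) := fun ε hε => by
    -- the optimal scale is `A / B`; adding `ε` keeps it positive and finite
    refine (h ((A + ε) / (B + ε)) (by positivity)).trans ?_
    have e1 : A ^ 2 / ((A + ε) / (B + ε)) ≤ A * (B + ε) := by
      rw [div_div_eq_mul_div, div_le_iff₀ (by positivity)]
      nlinarith [mul_nonneg (mul_nonneg hA hε.le) (add_nonneg hB hε.le)]
    have e2 : (A + ε) / (B + ε) * B ^ 2 ≤ (A + ε) * B := by
      rw [div_mul_eq_mul_div, div_le_iff₀ (by positivity)]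
      nlinarith [mul_nonneg (mul_nonneg (add_nonneg hA hε.le) hB) hε.le]
    linarith
  have h2 : Tendsto (fun ε : ℝ => 2 * (A * B) + ε * (A + B)) (𝓝[>] 0)
      (𝓝 (2 * (A * B) + 0 * (A + B))) :=
    (Continuous.tendsto (by fun_prop) 0).mono_left nhdsWithin_le_nhds
  rw [zero_mul, add_zero] at h2
  exact ge_of_tendsto h2 (eventually_mem_nhdsWithin.mono fun ε hε => h1 ε hε)

/-- The stability of the uncertainty principle on the completion. -/
theorem HasGradientSA.memLp_and_dist_sq_le_deficit (hN : 1 ≤ N) (hα : ∀ i, 0 ≤ α i)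
    {u : EuclideanSpace ℝ (Fin N) → ℝ} {G : EuclideanSpace ℝ (Fin N) → EuclideanSpace ℝ (Fin N)}
    (h : HasGradientSA α u G) :
    MemLp u 2 (wMeasure α) ∧ distGaussians α u ^ 2 ≤ deficit α u G := by
  obtain ⟨hu, hG, φ, hφ, hA₀, hB₀⟩ := h
  have hcont : ∀ n, Continuous (φ n) := fun n => (hφ n).smooth.continuous
  have hxm : AEStronglyMeasurable (fun x : EuclideanSpace ℝ (Fin N) => ‖x‖) (wMeasure α) :=
    continuous_norm.aestronglyMeasurable
  have hA : Tendsto (fun n => eLpNorm (gradient (φ n) - G) 2 (wMeasure α)) atTop (𝓝 0) :=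
    tendsto_eLpNorm_of_lintegral hA₀
  have hB : Tendsto (fun n => eLpNorm ((fun x => ‖x‖ * φ n x) - fun x => ‖x‖ * u x) 2
      (wMeasure α)) atTop (𝓝 0) := by
    refine tendsto_eLpNorm_of_lintegral (hB₀.congr fun n => lintegral_congr fun x => ?_)
    rw [Pi.sub_apply, ← mul_sub, enorm_mul, enorm_norm, mul_pow, mul_comm]
  have hM := tendsto_eLpNorm_of_approx hN hα hu hG hφ hA hB
  have mφ : ∀ n, MemLp (φ n) 2 (wMeasure α) := fun n =>
    memLp_two_of_hasCompactSupport hα (hcont n) (hφ n).compactSupport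
  have mg : ∀ n, MemLp (gradient (φ n)) 2 (wMeasure α) := fun n =>
    memLp_two_of_hasCompactSupport hα (continuous_gradient (hφ n).contDiff_one)
      (hasCompactSupport_gradient (hφ n).compactSupport)
  have mx : ∀ n, MemLp (fun x => ‖x‖ * φ n x) 2 (wMeasure α) := fun n =>
    memLp_two_of_hasCompactSupport hα (by have := hcont n; fun_prop)
      (hφ n).compactSupport.mul_left
  have mu : MemLp u 2 (wMeasure α) := memLp_of_tendsto mφ hu hM
  have mG : MemLp G 2 (wMeasure α) := memLp_of_tendsto mg hG hA
  have mxu : MemLp (fun x => ‖x‖ * u x) 2 (wMeasure α) := memLp_of_tendsto mx (hxm.mul hu) hB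
  refine ⟨mu, ?_⟩
  have hscale : ∀ s : ℝ, 0 < s → 2 * s * distGaussians α u ^ 2
      ≤ ∫ x, ‖G x‖ ^ 2 ∂wMeasure α + s ^ 2 * ∫ x, ‖‖x‖ * u x‖ ^ 2 ∂wMeasure α
        - s * homDim α * ∫ x, ‖u x‖ ^ 2 ∂wMeasure α := fun s hs => by
    set R : ℕ → ℝ := fun n => ∫ x, ‖gradient (φ n) x‖ ^ 2 ∂wMeasure α
      + s ^ 2 * ∫ x, ‖‖x‖ * φ n x‖ ^ 2 ∂wMeasure α
        - s * homDim α * ∫ x, ‖φ n x‖ ^ 2 ∂wMeasure α with hR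
    have hRlim : Tendsto R atTop (𝓝 (∫ x, ‖G x‖ ^ 2 ∂wMeasure α
        + s ^ 2 * ∫ x, ‖‖x‖ * u x‖ ^ 2 ∂wMeasure α
        - s * homDim α * ∫ x, ‖u x‖ ^ 2 ∂wMeasure α)) :=
      ((tendsto_integral_norm_sq mg mG hA).add
        ((tendsto_integral_norm_sq mx mxu hB).const_mul _)).sub
        ((tendsto_integral_norm_sq mφ mu hM).const_mul _)
    have hn : ∀ n, ∃ c : ℝ, 2 * s *
        ∫ x, ‖(φ n x - c * Real.exp (-(s / 2) * ‖x‖ ^ 2))‖ ^ 2 ∂wMeasure α ≤ R n := fun n => by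
      obtain ⟨c, hc⟩ := exists_gaussian_stability hs hα (hφ n).contDiff_one (hφ n).compactSupport
      refine ⟨c, ?_⟩
      rw [integral_norm_mul_sq] at hc
      simpa only [hR, Real.norm_eq_abs, sq_abs, abs_norm] using hc
    have hd : ∀ n, distGaussians α u
        ≤ (eLpNorm (φ n - u) 2 (wMeasure α)).toReal + √(R n / (2 * s)) := fun n => by
      obtain ⟨c, hc⟩ := hn n
      have mgs := memLp_gaussian hα (half_pos hs) c
      refine (distGaussians_le u hs c).trans ?_
      have e1 := sqrt_integral_norm_sq (mu.sub mgs)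
      have e2 := sqrt_integral_norm_sq ((mφ n).sub mgs)
      simp only [Pi.sub_apply, Real.norm_eq_abs] at e1 e2 hc
      rw [e1]
      have htri : (eLpNorm (u - fun x : EuclideanSpace ℝ (Fin N) =>
            c * Real.exp (-(s / 2) * ‖x‖ ^ 2)) 2 (wMeasure α)).toReal
          ≤ (eLpNorm (φ n - u) 2 (wMeasure α)).toReal + (eLpNorm (φ n -
            fun x : EuclideanSpace ℝ (Fin N) => c * Real.exp (-(s / 2) * ‖x‖ ^ 2)) 2
            (wMeasure α)).toReal := by
        rw [← ENNReal.toReal_add ((mφ n).sub mu).eLpNorm_ne_top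
          ((mφ n).sub mgs).eLpNorm_ne_top]
        refine ENNReal.toReal_mono (ENNReal.add_ne_top.2 ⟨((mφ n).sub mu).eLpNorm_ne_top,
          ((mφ n).sub mgs).eLpNorm_ne_top⟩) ?_
        rw [eLpNorm_sub_comm (φ n) u]
        refine le_trans (le_of_eq ?_) (eLpNorm_add_le (mu.sub (mφ n)).aestronglyMeasurable
          ((mφ n).sub mgs).aestronglyMeasurable one_le_two)
        congr 1
        abel
      refine htri.trans (add_le_add le_rfl ?_)
      rw [← e2]
      refine Real.sqrt_le_sqrt ?_
      rw [le_div_iff₀ (by positivity)]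
      linarith
    have hlim : Tendsto (fun n => (eLpNorm (φ n - u) 2 (wMeasure α)).toReal
        + √(R n / (2 * s))) atTop (𝓝 ((0 : ℝ≥0∞).toReal + √((∫ x, ‖G x‖ ^ 2 ∂wMeasure α
        + s ^ 2 * ∫ x, ‖‖x‖ * u x‖ ^ 2 ∂wMeasure α
        - s * homDim α * ∫ x, ‖u x‖ ^ 2 ∂wMeasure α) / (2 * s)))) :=
      ((ENNReal.tendsto_toReal ENNReal.zero_ne_top).comp hM).add (hRlim.div_const _).sqrt
    have hRnn : 0 ≤ ∫ x, ‖G x‖ ^ 2 ∂wMeasure α + s ^ 2 * ∫ x, ‖‖x‖ * u x‖ ^ 2 ∂wMeasure α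
        - s * homDim α * ∫ x, ‖u x‖ ^ 2 ∂wMeasure α := ge_of_tendsto' hRlim fun n => by
      obtain ⟨c, hc⟩ := hn n
      refine le_trans ?_ hc
      exact mul_nonneg (by positivity) (integral_nonneg fun x => by positivity)
    have h1 := ge_of_tendsto' hlim hd
    rw [ENNReal.toReal_zero, zero_add] at h1
    have h2 := pow_le_pow_left₀ (distGaussians_nonneg u) h1 2
    rw [Real.sq_sqrt (by positivity), le_div_iff₀ (by positivity)] at h2
    linarith
  have eB : ∫ x, |u x| ^ 2 * ‖x‖ ^ 2 ∂wMeasure α = ∫ x, ‖‖x‖ * u x‖ ^ 2 ∂wMeasure α := by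
    simp only [sq_abs, integral_norm_mul_sq]
  have key := le_two_mul_of_forall_scale (Real.sqrt_nonneg (∫ x, ‖G x‖ ^ 2 ∂wMeasure α))
    (Real.sqrt_nonneg (∫ x, ‖‖x‖ * u x‖ ^ 2 ∂wMeasure α))
    (C := 2 * distGaussians α u ^ 2 + homDim α * ∫ x, ‖u x‖ ^ 2 ∂wMeasure α) fun s hs => by
      rw [Real.sq_sqrt (integral_nonneg fun x => by positivity),
        Real.sq_sqrt (integral_nonneg fun x => by positivity), div_add' _ _ _ hs.ne',
        le_div_iff₀ hs]
      linarith [hscale s hs]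
  rw [deficit, eB]
  simp only [Real.norm_eq_abs] at key ⊢
  linarith

end Completion

/-! ### The extremal functions -/

section Extremal

variable {N : ℕ} {α : Fin N → ℝ}

lemma gradient_coord (i : Fin N) (x : EuclideanSpace ℝ (Fin N)) :
    gradient (fun x : EuclideanSpace ℝ (Fin N) => x i) x = EuclideanSpace.single i 1 := by
  refine HasGradientAt.gradient ?_
  rw [hasGradientAt_iff_hasFDerivAt]
  refine (EuclideanSpace.proj (𝕜 := ℝ) i).hasFDerivAt.congr_fderiv ?_
  ext y
  simp [EuclideanSpace.inner_single_left]

lemma differentiable_coord (i : Fin N) :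
    Differentiable ℝ fun x : EuclideanSpace ℝ (Fin N) => x i :=
  (EuclideanSpace.proj (𝕜 := ℝ) i).differentiable

lemma contDiff_coord (i : Fin N) {n : ℕ∞ω} :
    ContDiff ℝ n fun x : EuclideanSpace ℝ (Fin N) => x i :=
  (EuclideanSpace.proj (𝕜 := ℝ) i).contDiff

lemma gradient_coord_mul_radial (i : Fin N) (x : EuclideanSpace ℝ (Fin N)) {f : ℝ → ℝ} {f' : ℝ}
    (hf : HasDerivAt f f' (‖x‖ ^ 2)) :
    gradient (fun y : EuclideanSpace ℝ (Fin N) => y i * f (‖y‖ ^ 2)) x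
      = f (‖x‖ ^ 2) • EuclideanSpace.single i 1 + (2 * x i * f') • x := by
  rw [(hasGradientAt_mul_radial (differentiable_coord i x) hf).gradient, gradient_coord]

/-- A smooth cutoff on the line, equal to `1` on `(-∞, 1]` and to `0` on `[2, ∞)`. -/
noncomputable def cutoff (r : ℝ) : ℝ := Real.smoothTransition (2 - r)

lemma contDiff_cutoff : ContDiff ℝ ∞ cutoff :=
  Real.smoothTransition.contDiff.comp (contDiff_const.sub contDiff_id)

lemma cutoff_of_le {r : ℝ} (h : r ≤ 1) : cutoff r = 1 :=
  Real.smoothTransition.one_of_one_le (by linarith)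

lemma cutoff_of_ge {r : ℝ} (h : 2 ≤ r) : cutoff r = 0 :=
  Real.smoothTransition.zero_of_nonpos (by linarith)

lemma abs_cutoff_sub_one_le (r : ℝ) : |cutoff r - 1| ≤ 1 := by
  have h0 : 0 ≤ cutoff r := Real.smoothTransition.nonneg _
  have h1 : cutoff r ≤ 1 := Real.smoothTransition.le_one _
  exact abs_le.2 ⟨by linarith, by linarith⟩

lemma deriv_cutoff_of_lt {r : ℝ} (h : r < 1) : deriv cutoff r = 0 := by
  have : cutoff =ᶠ[𝓝 r] fun _ => 1 := by
    filter_upwards [gt_mem_nhds h] with y hy using cutoff_of_le hy.le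
  rw [this.deriv_eq, deriv_const]

lemma exists_abs_deriv_cutoff_le : ∃ C : ℝ, 0 ≤ C ∧ ∀ r, |deriv cutoff r| ≤ C := by
  have hc : HasCompactSupport (deriv cutoff) := by
    refine HasCompactSupport.intro (isCompact_Icc (a := (1 : ℝ)) (b := 2)) fun r hr => ?_
    by_cases h : r < 1
    · exact deriv_cutoff_of_lt h
    · have h2 : 2 < r := by
        by_contra h2
        exact hr ⟨not_lt.1 h, not_lt.1 h2⟩
      have : cutoff =ᶠ[𝓝 r] fun _ => 0 := by
        filter_upwards [lt_mem_nhds h2] with y hy using cutoff_of_ge hy.le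
      rw [this.deriv_eq, deriv_const]
  obtain ⟨C, hC⟩ := (contDiff_cutoff.continuous_deriv
    (by exact_mod_cast le_top)).bounded_above_of_compact_support hc
  exact ⟨C, (norm_nonneg _).trans (hC 0), hC⟩

/-- The radial profile of the approximants of `x i e^{-|x|² / 2}`, as a function of `|x|²`. -/
noncomputable def cutoffProfile (n : ℕ) (r : ℝ) : ℝ :=
  Real.exp (-(1 / 2) * r) * cutoff (r / (n + 1))

lemma contDiff_cutoffProfile (n : ℕ) : ContDiff ℝ ∞ (cutoffProfile n) :=
  (contDiff_const.mul contDiff_id).exp.mul (contDiff_cutoff.comp (contDiff_id.div_const _))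

lemma hasDerivAt_cutoffProfile (n : ℕ) (r : ℝ) :
    HasDerivAt (cutoffProfile n) (Real.exp (-(1 / 2) * r) *
      (-(1 / 2) * cutoff (r / (n + 1)) + deriv cutoff (r / (n + 1)) / (n + 1))) r := by
  have h1 : HasDerivAt (fun r : ℝ => cutoff (r / (n + 1)))
      (deriv cutoff (r / (n + 1)) * (1 / (n + 1))) r :=
    ((contDiff_cutoff.differentiable (by simp)) _).hasDerivAt.comp r
      ((hasDerivAt_id r).div_const _)
  refine ((hasDerivAt_exp_const_mul _ r).mul h1).congr_deriv ?_
  ring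

/-- The cut-off function is even in every coordinate other than `i`, hence satisfies the Neumann
condition on the faces `x j = 0` with `α j > 0`. -/
lemma isNeumannTest_cutoffProfile {i : Fin N} (hi : α i = 0) (n : ℕ) :
    IsNeumannTest α fun x => x i * cutoffProfile n (‖x‖ ^ 2) where
  smooth := (contDiff_coord i).mul ((contDiff_cutoffProfile n).comp (contDiff_norm_sq ℝ))
  compactSupport := by
    refine HasCompactSupport.intro (isCompact_closedBall 0 (2 * (n + 1) : ℝ)) fun x hx => ?_
    have hx' : 2 * (n + 1 : ℝ) < ‖x‖ := by simpa using hx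
    have h1 : 2 ≤ ‖x‖ ^ 2 / (n + 1) := by
      rw [le_div_iff₀ (by positivity)]
      have : (0 : ℝ) ≤ n := n.cast_nonneg
      nlinarith
    simp [cutoffProfile, cutoff_of_ge h1]
  neumann x _ j hj hxj := by
    have hij : j ≠ i := fun h => by rw [h, hi] at hj; exact lt_irrefl _ hj
    rw [gradient_coord_mul_radial i x (hasDerivAt_cutoffProfile n _)]
    simp [hij, hxj]

/-- Dominated convergence for errors of cutoffs. The exponent `3 / 8 < 1 / 2` leaves room to absorb
polynomial factors in front of `e^{-|x|² / 2}`. -/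
lemma tendsto_lintegral_of_eventually_zero {F : Type*} [NormedAddCommGroup F]
    (hα : ∀ i, 0 ≤ α i) {D : ℕ → EuclideanSpace ℝ (Fin N) → F} (hD : ∀ n, Continuous (D n))
    {K : ℝ} (hK : ∀ n x, ‖D n x‖ ≤ K * Real.exp (-(3 / 8) * ‖x‖ ^ 2))
    (h0 : ∀ x, ∀ᶠ n in atTop, D n x = 0) :
    Tendsto (fun n => ∫⁻ x, ‖D n x‖ₑ ^ 2 ∂wMeasure α) atTop (𝓝 0) := by
  have hint : Integrable (fun x : EuclideanSpace ℝ (Fin N) =>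
      (K * Real.exp (-(3 / 8) * ‖x‖ ^ 2)) ^ 2) (wMeasure α) := by
    refine integrable_of_le_exp (s := 3 / 4) (C := K ^ 2) (by norm_num) hα (by fun_prop)
      fun x => le_of_eq ?_
    rw [abs_of_nonneg (sq_nonneg _), mul_pow, ← Real.exp_nat_mul]
    congr 2
    push_cast; ring
  have := tendsto_lintegral_of_dominated_convergence (μ := wMeasure α)
    (F := fun n x => ‖D n x‖ₑ ^ 2) (f := fun _ => 0)
    (fun x => ENNReal.ofReal ((K * Real.exp (-(3 / 8) * ‖x‖ ^ 2)) ^ 2))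
    (fun n => (hD n).enorm.measurable.pow_const 2)
    (fun n => ae_of_all _ fun x => ?_) hint.lintegral_lt_top.ne
    (ae_of_all _ fun x => tendsto_const_nhds.congr' ?_)
  · simpa using this
  · dsimp only
    rw [← ofReal_norm, ← ENNReal.ofReal_pow (norm_nonneg _)]
    exact ENNReal.ofReal_le_ofReal (pow_le_pow_left₀ (norm_nonneg _) (hK n x) 2)
  · filter_upwards [h0 x] with n hn
    simp [hn]

lemma one_add_mul_exp_le {r : ℝ} :
    (1 + r) * Real.exp (-(1 / 2) * r) ≤ 8 * Real.exp (-(3 / 8) * r) := by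
  have h : Real.exp (-(3 / 8) * r) = Real.exp (r / 8) * Real.exp (-(1 / 2) * r) := by
    rw [← Real.exp_add]; congr 1; ring
  have h1 := Real.add_one_le_exp (r / 8)
  rw [h, ← mul_assoc]
  refine mul_le_mul_of_nonneg_right ?_ (Real.exp_pos _).le
  linarith

lemma eventually_div_lt_one (r : ℝ) : ∀ᶠ n : ℕ in atTop, r / (n + 1) < 1 := by
  obtain ⟨m, hm⟩ := exists_nat_gt r
  filter_upwards [eventually_ge_atTop m] with n hn
  rw [div_lt_one (by positivity)]
  have : (m : ℝ) ≤ n := by exact_mod_cast hn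
  linarith

lemma continuous_gradient_coord_mul_exp (i : Fin N) : Continuous
    (gradient fun x : EuclideanSpace ℝ (Fin N) => x i * Real.exp (-(1 / 2) * ‖x‖ ^ 2)) :=
  continuous_gradient ((contDiff_coord i).mul ((contDiff_const.mul (contDiff_norm_sq ℝ)).exp))

theorem hasGradientSA_coord_mul_exp (hα : ∀ i, 0 ≤ α i) {i : Fin N} (hi : α i = 0) :
    HasGradientSA α (fun x => x i * Real.exp (-(1 / 2) * ‖x‖ ^ 2))
      (gradient fun x => x i * Real.exp (-(1 / 2) * ‖x‖ ^ 2)) := by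
  have hgc := continuous_gradient_coord_mul_exp i
  refine ⟨Continuous.aestronglyMeasurable (by fun_prop), hgc.aestronglyMeasurable,
    fun n x => x i * cutoffProfile n (‖x‖ ^ 2), isNeumannTest_cutoffProfile hi, ?_, ?_⟩
  · obtain ⟨C, hC0, hC⟩ := exists_abs_deriv_cutoff_le
    have hdiff : ∀ (n : ℕ) (x : EuclideanSpace ℝ (Fin N)),
        gradient (fun x => x i * cutoffProfile n (‖x‖ ^ 2)) x
          - gradient (fun x => x i * Real.exp (-(1 / 2) * ‖x‖ ^ 2)) x
        = Real.exp (-(1 / 2) * ‖x‖ ^ 2) • ((cutoff (‖x‖ ^ 2 / (n + 1)) - 1) •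
            EuclideanSpace.single i 1
          + (x i * (-(cutoff (‖x‖ ^ 2 / (n + 1)) - 1)
            + 2 * (deriv cutoff (‖x‖ ^ 2 / (n + 1)) / (n + 1)))) • x) := fun n x => by
      rw [gradient_coord_mul_radial i x (hasDerivAt_cutoffProfile n _),
        gradient_coord_mul_radial i x (hasDerivAt_exp_const_mul (-(1 / 2)) _), cutoffProfile]
      module
    refine tendsto_lintegral_of_eventually_zero hα (K := 8 * (1 + 2 * C))
      (fun n => (continuous_gradient (isNeumannTest_cutoffProfile hi n).contDiff_one).sub hgc)
      (fun n x => ?_) fun x => ?_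
    · have hxi : |x i| ≤ ‖x‖ := by simpa using PiLp.norm_apply_le x i
      have h1 := abs_cutoff_sub_one_le (‖x‖ ^ 2 / (n + 1))
      have h2 : |deriv cutoff (‖x‖ ^ 2 / (n + 1)) / (n + 1)| ≤ C := by
        have hn : (1 : ℝ) ≤ n + 1 := by simp
        rw [abs_div, abs_of_pos (by positivity : (0 : ℝ) < n + 1)]
        exact (div_le_self (abs_nonneg _) hn).trans (hC _)
      have h3 : |-(cutoff (‖x‖ ^ 2 / (n + 1)) - 1)
          + 2 * (deriv cutoff (‖x‖ ^ 2 / (n + 1)) / (n + 1))| ≤ 1 + 2 * C := by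
        refine (abs_add_le _ _).trans ?_
        rw [abs_neg, abs_mul, abs_two]
        linarith
      rw [hdiff, norm_smul, Real.norm_eq_abs, Real.abs_exp]
      have h4 : ‖(cutoff (‖x‖ ^ 2 / (n + 1)) - 1) • EuclideanSpace.single i (1 : ℝ)
          + (x i * (-(cutoff (‖x‖ ^ 2 / (n + 1)) - 1)
            + 2 * (deriv cutoff (‖x‖ ^ 2 / (n + 1)) / (n + 1)))) • x‖
          ≤ (1 + 2 * C) * (1 + ‖x‖ ^ 2) := by
        refine (norm_add_le _ _).trans ?_
        rw [norm_smul, norm_smul, Real.norm_eq_abs, Real.norm_eq_abs, abs_mul,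
          PiLp.norm_single, norm_one, mul_one]
        have h5 : |x i| * |-(cutoff (‖x‖ ^ 2 / (n + 1)) - 1)
            + 2 * (deriv cutoff (‖x‖ ^ 2 / (n + 1)) / (n + 1))| * ‖x‖
            ≤ ‖x‖ * (1 + 2 * C) * ‖x‖ := by gcongr
        linarith
      calc _ ≤ Real.exp (-(1 / 2) * ‖x‖ ^ 2) * ((1 + 2 * C) * (1 + ‖x‖ ^ 2)) := by gcongr
        _ = (1 + 2 * C) * ((1 + ‖x‖ ^ 2) * Real.exp (-(1 / 2) * ‖x‖ ^ 2)) := by ring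
        _ ≤ (1 + 2 * C) * (8 * Real.exp (-(3 / 8) * ‖x‖ ^ 2)) := by
          exact mul_le_mul_of_nonneg_left one_add_mul_exp_le (by positivity)
        _ = _ := by ring
    · filter_upwards [eventually_div_lt_one (‖x‖ ^ 2)] with n hn
      rw [hdiff, cutoff_of_le hn.le, deriv_cutoff_of_lt hn]
      simp
  · have hdiff : ∀ (n : ℕ) (x : EuclideanSpace ℝ (Fin N)),
        x i * cutoffProfile n (‖x‖ ^ 2) - x i * Real.exp (-(1 / 2) * ‖x‖ ^ 2)
          = x i * (Real.exp (-(1 / 2) * ‖x‖ ^ 2) * (cutoff (‖x‖ ^ 2 / (n + 1)) - 1)) :=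
      fun n x => by rw [cutoffProfile]; ring
    have h := tendsto_lintegral_of_eventually_zero (α := α) hα (K := 8)
      (D := fun n x => (x i * cutoffProfile n (‖x‖ ^ 2)
        - x i * Real.exp (-(1 / 2) * ‖x‖ ^ 2)) * ‖x‖)
      (fun n => by
        have := (contDiff_cutoffProfile n).continuous
        fun_prop) (fun n x => ?_) fun x => ?_
    · refine h.congr fun n => lintegral_congr fun x => ?_
      rw [enorm_mul, enorm_norm, mul_pow]
    · have hxi : |x i| ≤ ‖x‖ := by simpa using PiLp.norm_apply_le x i
      have h1 := abs_cutoff_sub_one_le (‖x‖ ^ 2 / (n + 1))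
      rw [hdiff, norm_mul, norm_norm, norm_mul, norm_mul, Real.norm_eq_abs, Real.norm_eq_abs,
        Real.norm_eq_abs, Real.abs_exp]
      calc _ ≤ ‖x‖ * (Real.exp (-(1 / 2) * ‖x‖ ^ 2) * 1) * ‖x‖ := by gcongr
        _ ≤ (1 + ‖x‖ ^ 2) * Real.exp (-(1 / 2) * ‖x‖ ^ 2) := by
          nlinarith [Real.exp_pos (-(1 / 2) * ‖x‖ ^ 2)]
        _ ≤ _ := one_add_mul_exp_le
    · filter_upwards [eventually_div_lt_one (‖x‖ ^ 2)] with n hn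
      rw [hdiff, cutoff_of_le hn.le]
      simp

/-- The function vanishes at some points of the chamber and not at others, unlike a Gaussian. -/
lemma coord_mul_exp_not_gaussian (hα : ∀ i, 0 ≤ α i) {i : Fin N} (hi : α i = 0)
    {v : EuclideanSpace ℝ (Fin N) → ℝ} (hv : v ∈ gaussians N) :
    ¬ (fun x : EuclideanSpace ℝ (Fin N) => x i * Real.exp (-(1 / 2) * ‖x‖ ^ 2))
      =ᵐ[wMeasure α] v := by
  obtain ⟨a, b, hb, rfl⟩ := hv
  intro h
  have h1 : (fun x : EuclideanSpace ℝ (Fin N) => x i * Real.exp (-(1 / 2) * ‖x‖ ^ 2))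
      =ᵐ[volume.restrict (chamber α)] fun x => a * Real.exp (-b * ‖x‖ ^ 2) := by
    have h2 := (ae_withDensity_iff measurable_weight.ennreal_ofReal).1 h
    filter_upwards [h2, ae_restrict_mem measurableSet_chamber] with x hx hxc
    exact hx (ENNReal.ofReal_pos.2 (weight_pos hα hxc)).ne'
  have h3 := Measure.eqOn_open_of_ae_eq h1 isOpen_chamber
    (Continuous.continuousOn (by fun_prop)) (Continuous.continuousOn (by fun_prop))
  have hmem : ∀ t : ℝ, WithLp.toLp 2 (Function.update (fun _ => (1 : ℝ)) i t) ∈ chamber α :=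
    fun t j hj => by
      have hji : j ≠ i := fun h => by rw [h, hi] at hj; exact lt_irrefl _ hj
      simp [hji]
  have e0 := h3 (hmem 0)
  have e1 := h3 (hmem 1)
  simp only [Function.update_self, zero_mul, one_mul] at e0 e1
  have ha : a = 0 := by
    rcases mul_eq_zero.1 e0.symm with h | h
    · exact h
    · exact absurd h (Real.exp_pos _).ne'
  rw [ha, zero_mul] at e1
  exact (Real.exp_pos _).ne' e1

lemma integral_coord_mul_exp_eq_zero (hα : ∀ i, 0 ≤ α i) {i : Fin N} (hi : α i = 0) {s : ℝ}
    (hs : 0 < s) : ∫ x, x i * Real.exp (-s * ‖x‖ ^ 2) ∂wMeasure α = 0 := by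
  have := fun i => isProbabilityMeasure_lineMeasure hs (hα i)
  rw [integral_mul_exp_wMeasure hs hα fun x => x i]
  have h : ∫ y : Fin N → ℝ, y i ∂piMeasure s α = ∫ t, t ∂lineMeasure s (α i) :=
    integral_comp_eval (X := fun _ : Fin N => ℝ) (μ := fun i => lineMeasure s (α i))
      (f := fun t : ℝ => t) continuous_id.aestronglyMeasurable
  rw [h, integral_lineMeasure hs (hα i), hi, ray_zero, setIntegral_univ]
  have hodd := integral_neg_eq_self (fun t => t * lineWeight s 0 t) (volume : Measure ℝ)
  simp only [lineWeight, Real.rpow_zero, one_mul, neg_sq, neg_mul, integral_neg] at hodd ⊢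
  rw [show ∫ t : ℝ, t * Real.exp (-(s * t ^ 2)) = 0 by linarith]
  simp

lemma integrable_mul_exp_of_le (hα : ∀ i, 0 ≤ α i) {F : EuclideanSpace ℝ (Fin N) → ℝ}
    (hF : Continuous F) (hb : ∀ x, |F x| ≤ (1 + ‖x‖ ^ 2) ^ 2) :
    Integrable (fun x => F x * Real.exp (-1 * ‖x‖ ^ 2)) (wMeasure α) := by
  refine integrable_of_le_exp (s := 3 / 4) (C := 64) (by norm_num) hα (by fun_prop) fun x => ?_
  have e1 : Real.exp (-1 * ‖x‖ ^ 2) = Real.exp (-(1 / 2) * ‖x‖ ^ 2) ^ 2 := by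
    rw [← Real.exp_nat_mul]; congr 1; push_cast; ring
  have e2 : Real.exp (-(3 / 4) * ‖x‖ ^ 2) = Real.exp (-(3 / 8) * ‖x‖ ^ 2) ^ 2 := by
    rw [← Real.exp_nat_mul]; congr 1; push_cast; ring
  rw [abs_mul, Real.abs_exp, e1, e2]
  calc _ ≤ (1 + ‖x‖ ^ 2) ^ 2 * Real.exp (-(1 / 2) * ‖x‖ ^ 2) ^ 2 := by gcongr; exact hb x
    _ = ((1 + ‖x‖ ^ 2) * Real.exp (-(1 / 2) * ‖x‖ ^ 2)) ^ 2 := by ring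
    _ ≤ (8 * Real.exp (-(3 / 8) * ‖x‖ ^ 2)) ^ 2 :=
      pow_le_pow_left₀ (by positivity) one_add_mul_exp_le 2
    _ = _ := by ring

lemma coord_sq_le_norm_sq (x : EuclideanSpace ℝ (Fin N)) (i : Fin N) : x i ^ 2 ≤ ‖x‖ ^ 2 := by
  rw [EuclideanSpace.real_norm_sq_eq]
  exact Finset.single_le_sum (f := fun j => x j ^ 2) (fun j _ => sq_nonneg _) (Finset.mem_univ i)

lemma integrable_coord_sq_mul_exp (hα : ∀ i, 0 ≤ α i) (i : Fin N) :
    Integrable (fun x => x i ^ 2 * Real.exp (-1 * ‖x‖ ^ 2)) (wMeasure α) :=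
  integrable_mul_exp_of_le hα (by fun_prop) fun x => by
    rw [abs_of_nonneg (sq_nonneg _)]
    nlinarith [coord_sq_le_norm_sq x i, sq_nonneg (‖x‖ ^ 2), sq_nonneg ‖x‖]

lemma integrable_coord_sq_mul_coord_sq_mul_exp (hα : ∀ i, 0 ≤ α i) (i j : Fin N) :
    Integrable (fun x => x i ^ 2 * x j ^ 2 * Real.exp (-1 * ‖x‖ ^ 2)) (wMeasure α) :=
  integrable_mul_exp_of_le hα (by fun_prop) fun x => by
    rw [abs_of_nonneg (by positivity)]
    have := mul_le_mul (coord_sq_le_norm_sq x i) (coord_sq_le_norm_sq x j) (sq_nonneg _)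
      (sq_nonneg _)
    nlinarith [sq_nonneg ‖x‖]

/-- The second moment in a coordinate of exponent `0` is half the mass: integrate by parts. -/
lemma two_mul_integral_coord_sq_mul_exp (hα : ∀ i, 0 ≤ α i) {i : Fin N} (hi : α i = 0) :
    2 * ∫ x, x i ^ 2 * Real.exp (-1 * ‖x‖ ^ 2) ∂wMeasure α
      = ∫ x, Real.exp (-1 * ‖x‖ ^ 2) ∂wMeasure α := by
  have h0 : Integrable (fun x => 1 * Real.exp (-1 * ‖x‖ ^ 2)) (wMeasure α) :=
    integrable_mul_exp_of_le hα continuous_const fun x => by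
      rw [abs_one]; nlinarith [sq_nonneg ‖x‖, sq_nonneg (‖x‖ ^ 2)]
  have hg : ∀ x : EuclideanSpace ℝ (Fin N),
      x i * gradient (fun y => 1 * Real.exp (-1 * ‖y‖ ^ 2)) x i
        = -2 * (x i ^ 2 * Real.exp (-1 * ‖x‖ ^ 2)) := fun x => by
    rw [gradient_mul_exp (differentiable_const _), gradient_fun_const]
    simp only [PiLp.smul_apply, PiLp.add_apply, PiLp.zero_apply, smul_eq_mul]
    ring
  have hint := integrable_coord_sq_mul_exp hα i
  have h := integral_coord_mul_gradient_wMeasure hα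
    (f := fun x => 1 * Real.exp (-1 * ‖x‖ ^ 2))
    ((differentiable_const _).mul (((differentiable_id.norm_sq ℝ).const_mul _).exp)) i h0
    (by simp only [hg]; exact hint.const_mul _) (by simpa only [one_mul] using hint)
  simp only [hg] at h
  simp only [integral_const_mul, hi, one_mul] at h
  linarith

/-- The virial identity `∫ |x|² x_i² e^{-|x|²} x ^ A = (D / 2 + 1) ∫ x_i² e^{-|x|²} x ^ A`. -/
lemma integral_coord_sq_mul_norm_sq_mul_exp (hα : ∀ i, 0 ≤ α i) (i : Fin N) :
    ∫ x, x i ^ 2 * ‖x‖ ^ 2 * Real.exp (-1 * ‖x‖ ^ 2) ∂wMeasure α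
      = (homDim α / 2 + 1) * ∫ x, x i ^ 2 * Real.exp (-1 * ‖x‖ ^ 2) ∂wMeasure α := by
  have hd : Differentiable ℝ fun x : EuclideanSpace ℝ (Fin N) => x i ^ 2 :=
    (differentiable_coord i).pow 2
  have hgi : ∀ (x : EuclideanSpace ℝ (Fin N)) (j : Fin N),
      gradient (fun x : EuclideanSpace ℝ (Fin N) => x i ^ 2) x j
        = if i = j then 2 * x i else 0 := fun x j => by
    rw [gradient_apply, ((differentiable_coord i x).hasFDerivAt.pow 2).fderiv]
    have := gradient_apply (F := fun x : EuclideanSpace ℝ (Fin N) => x i) x j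
    rw [gradient_coord] at this
    simp [← this, eq_comm]
  have hg : ∀ (j : Fin N) (x : EuclideanSpace ℝ (Fin N)),
      x j * gradient (fun y : EuclideanSpace ℝ (Fin N) => y i ^ 2 * Real.exp (-1 * ‖y‖ ^ 2)) x j
        = (if i = j then 2 else 0) * (x i ^ 2 * Real.exp (-1 * ‖x‖ ^ 2))
          - 2 * (x i ^ 2 * x j ^ 2 * Real.exp (-1 * ‖x‖ ^ 2)) := fun j x => by
    rw [gradient_mul_exp hd]
    simp only [PiLp.smul_apply, PiLp.add_apply, smul_eq_mul, hgi]
    split_ifs with h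
    · subst h; ring
    · ring
  have hM := integrable_coord_sq_mul_exp hα i
  have hT := integrable_coord_sq_mul_coord_sq_mul_exp hα i
  have key : ∀ j, (if i = j then 2 else 0) * ∫ x, x i ^ 2 * Real.exp (-1 * ‖x‖ ^ 2) ∂wMeasure α
      - 2 * ∫ x, x i ^ 2 * x j ^ 2 * Real.exp (-1 * ‖x‖ ^ 2) ∂wMeasure α
      = -(α j + 1) * ∫ x, x i ^ 2 * Real.exp (-1 * ‖x‖ ^ 2) ∂wMeasure α := fun j => by
    have h1 := (hM.const_mul (if i = j then 2 else 0)).sub ((hT j).const_mul 2)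
    have h := integral_coord_mul_gradient_wMeasure hα
      (f := fun x => x i ^ 2 * Real.exp (-1 * ‖x‖ ^ 2))
      (hd.mul (((differentiable_id.norm_sq ℝ).const_mul _).exp)) j hM
      (by simp only [hg]; exact h1)
      ((hT j).congr (ae_of_all _ fun x => by ring))
    simp only [hg] at h
    rwa [integral_sub (hM.const_mul _) ((hT j).const_mul 2), integral_const_mul,
      integral_const_mul] at h
  have hsum := Finset.sum_congr rfl fun j (_ : j ∈ Finset.univ) => key j
  rw [Finset.sum_sub_distrib, ← Finset.sum_mul, ← Finset.sum_mul, ← Finset.mul_sum,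
    ← integral_finsetSum _ fun j _ => hT j] at hsum
  have e : ∀ x : EuclideanSpace ℝ (Fin N), ∑ j, x i ^ 2 * x j ^ 2 * Real.exp (-1 * ‖x‖ ^ 2)
      = x i ^ 2 * ‖x‖ ^ 2 * Real.exp (-1 * ‖x‖ ^ 2) := fun x => by
    rw [← Finset.sum_mul, ← Finset.mul_sum, EuclideanSpace.real_norm_sq_eq]
  have eD : ∑ j, -(α j + 1) = -homDim α := by
    simp only [neg_add_rev, Finset.sum_add_distrib, Finset.sum_neg_distrib, Finset.sum_const,
      Finset.card_univ, Fintype.card_fin, nsmul_eq_mul, homDim]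
    ring
  simp only [e, eD, Finset.sum_ite_eq, Finset.mem_univ, if_true] at hsum
  linarith

lemma sq_mul_exp_neg_half (a : ℝ) (x : EuclideanSpace ℝ (Fin N)) :
    (a * Real.exp (-(1 / 2) * ‖x‖ ^ 2)) ^ 2 = a ^ 2 * Real.exp (-1 * ‖x‖ ^ 2) := by
  rw [mul_pow, ← Real.exp_nat_mul]; congr 2; push_cast; ring

/-- For `u = x i e^{-|x|² / 2}` with `α i = 0`, the two factors of the uncertainty product are
equal, and all moments are multiples of `∫ u² x ^ A`. -/
theorem deficit_coord_mul_exp (hα : ∀ i, 0 ≤ α i) {i : Fin N} (hi : α i = 0) :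
    deficit α (fun x => x i * Real.exp (-(1 / 2) * ‖x‖ ^ 2))
      (gradient fun x => x i * Real.exp (-(1 / 2) * ‖x‖ ^ 2))
      = ∫ x, x i ^ 2 * Real.exp (-1 * ‖x‖ ^ 2) ∂wMeasure α := by
  have hM := integrable_coord_sq_mul_exp hα i
  have hZ : Integrable (fun x => Real.exp (-1 * ‖x‖ ^ 2)) (wMeasure α) :=
    integrable_of_le_exp one_pos hα (by fun_prop) (C := 1) fun x => by
      rw [Real.abs_exp, one_mul]
  have hB : Integrable (fun x => x i ^ 2 * ‖x‖ ^ 2 * Real.exp (-1 * ‖x‖ ^ 2)) (wMeasure α) :=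
    integrable_mul_exp_of_le hα (by fun_prop) fun x => by
      rw [abs_of_nonneg (by positivity)]
      nlinarith [mul_le_mul_of_nonneg_right (coord_sq_le_norm_sq x i) (sq_nonneg ‖x‖),
        sq_nonneg ‖x‖]
  have e1 : ∀ x : EuclideanSpace ℝ (Fin N),
      ‖gradient (fun x : EuclideanSpace ℝ (Fin N) => x i * Real.exp (-(1 / 2) * ‖x‖ ^ 2)) x‖ ^ 2
        = Real.exp (-1 * ‖x‖ ^ 2) - 2 * (x i ^ 2 * Real.exp (-1 * ‖x‖ ^ 2))
          + x i ^ 2 * ‖x‖ ^ 2 * Real.exp (-1 * ‖x‖ ^ 2) := fun x => by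
    have hn : ‖EuclideanSpace.single i (1 : ℝ) + (2 * -(1 / 2) * x i) • x‖ ^ 2
        = 1 - 2 * x i ^ 2 + x i ^ 2 * ‖x‖ ^ 2 := by
      rw [norm_add_sq_real, norm_smul, inner_smul_right, EuclideanSpace.inner_single_left,
        PiLp.norm_single, mul_pow, Real.norm_eq_abs, Real.norm_eq_abs, sq_abs, sq_abs]
      simp
      ring
    rw [gradient_mul_exp (differentiable_coord i), gradient_coord, norm_smul, mul_pow, hn,
      Real.norm_eq_abs, Real.abs_exp, ← Real.exp_nat_mul,
      show ((2 : ℕ) : ℝ) * (-(1 / 2) * ‖x‖ ^ 2) = -1 * ‖x‖ ^ 2 by push_cast; ring]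
    ring
  have e2 : ∀ x : EuclideanSpace ℝ (Fin N),
      x i ^ 2 * Real.exp (-1 * ‖x‖ ^ 2) * ‖x‖ ^ 2
        = x i ^ 2 * ‖x‖ ^ 2 * Real.exp (-1 * ‖x‖ ^ 2) := fun x => by ring
  have hA : ∫ x, ‖gradient (fun x : EuclideanSpace ℝ (Fin N) =>
        x i * Real.exp (-(1 / 2) * ‖x‖ ^ 2)) x‖ ^ 2 ∂wMeasure α
      = ∫ x, x i ^ 2 * ‖x‖ ^ 2 * Real.exp (-1 * ‖x‖ ^ 2) ∂wMeasure α := by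
    have h1 : Integrable (fun x => Real.exp (-1 * ‖x‖ ^ 2)
        - 2 * (x i ^ 2 * Real.exp (-1 * ‖x‖ ^ 2))) (wMeasure α) := hZ.sub (hM.const_mul 2)
    simp only [e1]
    rw [integral_add h1 hB, integral_sub hZ (hM.const_mul 2), integral_const_mul,
      two_mul_integral_coord_sq_mul_exp hα hi]
    ring
  rw [deficit, hA]
  simp only [sq_abs, sq_mul_exp_neg_half, e2]
  rw [Real.mul_self_sqrt (integral_nonneg fun x => by positivity),
    integral_coord_sq_mul_norm_sq_mul_exp hα i]
  ring

/-- `x i e^{-|x|² / 2}` is orthogonal to all radial functions, so `0` is the nearest Gaussian. -/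
theorem distGaussians_coord_mul_exp_sq (hα : ∀ i, 0 ≤ α i) {i : Fin N} (hi : α i = 0) :
    distGaussians α (fun x => x i * Real.exp (-(1 / 2) * ‖x‖ ^ 2)) ^ 2
      = ∫ x, x i ^ 2 * Real.exp (-1 * ‖x‖ ^ 2) ∂wMeasure α := by
  have hM0 : 0 ≤ ∫ x, x i ^ 2 * Real.exp (-1 * ‖x‖ ^ 2) ∂wMeasure α :=
    integral_nonneg fun x => by positivity
  suffices h : distGaussians α (fun x => x i * Real.exp (-(1 / 2) * ‖x‖ ^ 2))
      = √(∫ x, x i ^ 2 * Real.exp (-1 * ‖x‖ ^ 2) ∂wMeasure α) by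
    rw [h, Real.sq_sqrt hM0]
  refine le_antisymm ?_ ?_
  · refine (distGaussians_le _ one_pos 0).trans_eq ?_
    simp only [zero_mul, sub_zero, sq_abs, sq_mul_exp_neg_half]
  · have : Nonempty (ℝ × {l : ℝ // l ≠ 0}) := ⟨(0, ⟨1, one_ne_zero⟩)⟩
    refine le_ciInf fun p => Real.sqrt_le_sqrt ?_
    obtain ⟨c, l, hl⟩ := p
    obtain ⟨b, hb⟩ : ∃ b, b = 1 / (2 * l ^ 2) := ⟨_, rfl⟩
    have hb0 : 0 < b := by rw [hb]; positivity
    have hexp : ∀ x : EuclideanSpace ℝ (Fin N),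
        |x i * Real.exp (-(1 / 2) * ‖x‖ ^ 2) - c * Real.exp (-b * ‖x‖ ^ 2)| ^ 2
          = x i ^ 2 * Real.exp (-1 * ‖x‖ ^ 2)
            - 2 * c * (x i * Real.exp (-(1 / 2 + b) * ‖x‖ ^ 2))
            + (c * Real.exp (-b * ‖x‖ ^ 2)) ^ 2 := fun x => by
      rw [sq_abs, ← sq_mul_exp_neg_half, show -(1 / 2 + b) * ‖x‖ ^ 2
        = -(1 / 2) * ‖x‖ ^ 2 + -b * ‖x‖ ^ 2 by ring, Real.exp_add]
      ring
    have i1 := integrable_coord_sq_mul_exp hα i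
    have i3 := (memLp_gaussian hα hb0 c).integrable_sq
    have i2 : Integrable (fun x => x i * Real.exp (-(1 / 2 + b) * ‖x‖ ^ 2)) (wMeasure α) := by
      refine integrable_of_le_exp (s := 3 / 8) (C := 8) (by norm_num) hα (by fun_prop) fun x => ?_
      refine le_trans ?_ one_add_mul_exp_le
      rw [abs_mul, Real.abs_exp]
      gcongr
      · have hxi := coord_sq_le_norm_sq x i
        rw [← sq_abs] at hxi
        nlinarith [sq_nonneg (|x i| - 1)]
      · linarith
    have i12 : Integrable (fun x => x i ^ 2 * Real.exp (-1 * ‖x‖ ^ 2)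
        - 2 * c * (x i * Real.exp (-(1 / 2 + b) * ‖x‖ ^ 2))) (wMeasure α) :=
      i1.sub (i2.const_mul _)
    simp only [← hb, hexp]
    rw [integral_add i12 i3, integral_sub i1 (i2.const_mul _), integral_const_mul,
      integral_coord_mul_exp_eq_zero hα hi (by positivity), mul_zero, sub_zero]
    exact le_add_of_nonneg_right (integral_nonneg fun x => by positivity)

end Extremal

end MonomialHUP

theorem theorem1p1 (N : ℕ) (hN : 1 ≤ N) (α : Fin N → ℝ) (hα : ∀ i, 0 ≤ α i) :
    (∀ (u : EuclideanSpace ℝ (Fin N) → ℝ)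
        (G : EuclideanSpace ℝ (Fin N) → EuclideanSpace ℝ (Fin N)),
        MonomialHUP.HasGradientSA α u G →
        MemLp u 2 (MonomialHUP.wMeasure α) ∧
        MonomialHUP.distGaussians α u ^ 2 ≤ MonomialHUP.deficit α u G) ∧
    (MonomialHUP.IsPartial α →
      ∃ (u : EuclideanSpace ℝ (Fin N) → ℝ)
        (G : EuclideanSpace ℝ (Fin N) → EuclideanSpace ℝ (Fin N)),
        MonomialHUP.HasGradientSA α u G ∧
        (∀ v ∈ MonomialHUP.gaussians N, ¬ u =ᵐ[MonomialHUP.wMeasure α] v) ∧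
        MonomialHUP.deficit α u G = MonomialHUP.distGaussians α u ^ 2) ∧
    (∀ (i : Fin N), α i = 0 → ∀ (u : EuclideanSpace ℝ (Fin N) → ℝ),
        (u = fun x => x i * Real.exp (-‖x‖ ^ 2 / 2)) →
        MonomialHUP.HasGradientSA α u (gradient u) ∧
        (∀ v ∈ MonomialHUP.gaussians N, ¬ u =ᵐ[MonomialHUP.wMeasure α] v) ∧
        MonomialHUP.deficit α u (gradient u) = MonomialHUP.distGaussians α u ^ 2) := by
  have extremal : ∀ (i : Fin N), α i = 0 → ∀ (u : EuclideanSpace ℝ (Fin N) → ℝ),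
      (u = fun x => x i * Real.exp (-‖x‖ ^ 2 / 2)) →
      MonomialHUP.HasGradientSA α u (gradient u) ∧
      (∀ v ∈ MonomialHUP.gaussians N, ¬ u =ᵐ[MonomialHUP.wMeasure α] v) ∧
      MonomialHUP.deficit α u (gradient u) = MonomialHUP.distGaussians α u ^ 2 := by
    intro i hi u hu
    have hu' : u = fun x => x i * Real.exp (-(1 / 2) * ‖x‖ ^ 2) := by
      rw [hu]; funext x; congr 2; ring
    rw [hu']
    exact ⟨MonomialHUP.hasGradientSA_coord_mul_exp hα hi,
      fun v hv => MonomialHUP.coord_mul_exp_not_gaussian hα hi hv,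
      (MonomialHUP.deficit_coord_mul_exp hα hi).trans
        (MonomialHUP.distGaussians_coord_mul_exp_sq hα hi).symm⟩
  refine ⟨fun u G h => h.memLp_and_dist_sq_le_deficit hN hα, fun hpart => ?_, extremal⟩
  obtain ⟨i, hi⟩ := not_forall.1 hpart
  exact ⟨_, _, extremal i (le_antisymm (not_lt.1 hi) (hα i)) _ rfl⟩
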